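/- **Setting.** Let $T$ be a non-empty compact Hausdorff space and $\mathcal A$ a class of closed subsets of $T$ which is closed under arbitrary intersections, contains $\emptyset$ and $T$, contains no two disjoint non-empty sets, and is separable from above: there are maps $g_m$ and finite sub-semilattices $\mathcal A_m\subseteq\mathcal A_{m+1}$ of $\mathcal A$ such that $A=\bigcap_m g_m(A)$, $g_{m+1}(A)\subseteq g_m(A)$, $A\subseteq g_m(A)^0$, each $g_m(A)$ is a finite union of sets of $\mathcal A_m$, each $g_m$ preserves arbitrary intersections and finite unions, and $g_m(\emptyset)=\emptyset$. Let $\emptyset'$ be the intersection of all non-empty members of $\mathcal A$, and $\mathcal A(u)$ the class of finite unions of members of $\mathcal A$. A *consistent ordering* of a finite semilattice $\mathcal A'\subseteq\mathcal A$ of non-empty sets is a list $A_0=\emptyset',A_1,\dots,A_n$ such that $A_1=\bigcap_{A\in\mathcal A'}A$, the sets $A_1,\dots,A_n$ are distinct and exhaust $\mathcal A'$, and every $A\in\mathcal A'$ with $A\subsetneq A_i$ is some $A_j$ with $1\le j<i$. A *flow* is an increasing map from an interval $[s,e]$ to a class of sets; it is *continuous* if $f(r)=\bigcap_m f(r_m)$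 when $r_m\downarrow r$ and $f(r)=\overline{\bigcup_m f(r_m)}$ when $r_m\uparrow r$. A *simple flow* is a continuous flow $f:[0,a]\to\mathcal A(u)$ with $f(0)=\emptyset'$ for which there are a partition $0=s_0<\dots<s_N=a$ and flows $\varphi_{i+1}:[s_i,s_{i+1}]\to\mathcal A$ with $f(r)=\bigcup_{j=1}^i\varphi_j(s_j)\cup\varphi_{i+1}(r)$ on $[s_i,s_{i+1}]$. A simple flow $f:[0,a]\to\mathcal A(u)$ *connects* the sets of $\mathcal A'$ in the sense of the ordering, with partition $0=t_0<t_1<\dots<t_n=a$, if for each $i<n$ there is a continuous flow $f_{i+1}:[t_i,t_{i+1}]\to\mathcal A$ with $f_{i+1}(t_i)\subseteq\bigcup_{j=0}^iA_j$, $f_{i+1}(t_{i+1})=A_{i+1}$ and $f(r)=\bigcup_{j=0}^iA_j\cup f_{i+1}(r)$ for $r\in[t_i,t_{i+1}]$; in particular $f(t_i)=\bigcup_{j=0}^iA_j$. Let $\{A_0=\emptyset',A_1,\dots,A_n\}$ and $\{A_0=\emptyset',A'_1,\dots,A'_n\}$ be two consistent orderings of the same finite semilattice $\mathcal A'$, with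 $A_i=A'_{\pi(i)}$ for a permutation $\pi$ of $\{1,\dots,n\}$ with $\pi(1)=1$. Let $f:[0,a]\to\mathcal A(u)$ and $g:[0,b]\to\mathcal A(u)$ be simple flows connecting the sets of $\mathcal A'$ in the sense of the first and of the second ordering, with partitions $(t_i)$ and $(u_i)$. Let $(Q^f_{st})_{0\le s\le t\le a}$ and $(Q^g_{st})_{0\le s\le t\le b}$ be transition systems on $\mathbb R$ (Markov kernels with $Q_{ss}(x;\cdot)=\delta_x$ satisfying the Chapman–Kolmogorov equations), $T_{st}h(x)=\int h(y)\,Q_{st}(x;dy)$ the associated operators on the Banach space $B(\mathbb R)$ of bounded Borel functions with the supremum norm, and $\mathcal D$ a dense subspace of $B(\mathbb R)$ such that, for both systems, $T_{st}\mathcal D\subseteq\mathcal D$, for $h\in\mathcal D$ the function $T_{st}h$ is strongly continuously differentiable in $s$ and in $t$, and $-\frac{\partial^-}{\partial r}T_{rs}h|_{r=s}=\frac{\partial^+}{\partial t}T_{st}h|_{t=s}$ for all $s$ in the open time interval. Let $\mathcal G_s h=\lim_{r\uparrow s}(T_{rs}h-h)/(s-r)$ (limit in $B(\mathbb R)$,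 defined for those $h\in B(\mathbb R)$ for which it exists) be the generators $\mathcal G^f_s,\mathcal G^g_s$. Let $\mu$ be a probability measure on $\mathbb R$ and $\mu^f_{t_1}(\Gamma)=\int Q^f_{0t_1}(x;\Gamma)\,\mu(dx)$. Assume $Q^f_{0t_1}=Q^g_{0u_1}$. For $2\le i\le n$ let $l_1\le\dots\le l_{2(i-1)}$ be the increasing ordering of $\pi(2)-1,\pi(2),\dots,\pi(i)-1,\pi(i)$, let $l_0=1$, and let $p$ be the index with $\pi(i)-1=l_{p-1}$, $\pi(i)=l_p$. Write $\Delta_j=y_{\pi(j)}-y_{\pi(j)-1}$. In a product of operators applied to a function of $x_1$ and the $y_l$, with value taken at $x_1$, the factor $T^g_{u_ku_l}$ integrates the variable $y_l$ with respect to $Q^g_{u_ku_l}(y_k;dy_l)$ (with $y_1=x_1$ for the first factor), in the order in which the factors are written; $\mathcal G^g_vT^g_{vu_{l_p}}$ acts on the variable $y_{l_p}$, with the earlier variables fixed, and the result is evaluated at $y_{l_{p-1}}$. **Claim.** For all $2\le i\le n$, $h_2,\dots,h_i\in\mathcal D$ and $x_1\in\mathbb R$ both sides of the identities (b1), (b2)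 below are defined (the functions to which the generators are applied belong to their domains, and the integrals over the time intervals exist), and the following two statements are equivalent. (a) For all Borel sets $\Gamma_0,\dots,\Gamma_n\subseteq\mathbb R$, $$\int I_{\Gamma_0}(x_0)I_{\Gamma_1}(x_1)\prod_{i=2}^nI_{\Gamma_i}(x_i-x_{i-1})\,Q^f_{t_{n-1}t_n}(x_{n-1};dx_n)\cdots Q^f_{0t_1}(x_0;dx_1)\mu(dx_0)$$ $$=\int I_{\Gamma_0}(y_0)I_{\Gamma_1}(y_1)\prod_{i=2}^nI_{\Gamma_i}(y_{\pi(i)}-y_{\pi(i)-1})\,Q^g_{u_{n-1}u_n}(y_{n-1};dy_n)\cdots Q^g_{0u_1}(y_0;dy_1)\mu(dy_0).$$ (b) For each $i=2,\dots,n$, all $h_2,\dots,h_i\in\mathcal D$ and $\mu^f_{t_1}$-almost all $x_1$: (b1) if $p=2(i-1)$, $$\int_{t_{i-1}}^{t_i}T^g_{u_1u_{l_1}}T^g_{u_{l_1}u_{l_2}}\cdots T^g_{u_{l_{p-3}}u_{l_{p-2}}}\Big[\prod_{j=2}^{i-1}h_j(\Delta_j)\,(\mathcal G^f_wT^f_{wt_i}h_i)\Big(x_1+\sum_{j=2}^{i-1}\Delta_j\Big)\Big](x_1)\,dw$$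 $$=\int_{u_{l_{p-1}}}^{u_{l_p}}T^g_{u_1u_{l_1}}\cdots T^g_{u_{l_{p-2}}u_{l_{p-1}}}\mathcal G^g_vT^g_{vu_{l_p}}\Big[\prod_{j=2}^{i-1}h_j(\Delta_j)\,h_i\Big(x_1+\sum_{j=2}^{i}\Delta_j\Big)\Big](x_1)\,dv;$$ (b2) if $p<2(i-1)$, $$\int_{t_{i-1}}^{t_i}T^g_{u_1u_{l_1}}\cdots T^g_{u_{l_{p-3}}u_{l_{p-2}}}T^g_{u_{l_{p-2}}u_{l_{p+1}}}T^g_{u_{l_{p+1}}u_{l_{p+2}}}\cdots T^g_{u_{l_{2(i-1)-1}}u_{l_{2(i-1)}}}\Big[\prod_{j=2}^{i-1}h_j(\Delta_j)\,(\mathcal G^f_wT^f_{wt_i}h_i)\Big(x_1+\sum_{j=2}^{i-1}\Delta_j\Big)\Big](x_1)\,dw$$ $$=\int_{u_{l_{p-1}}}^{u_{l_p}}T^g_{u_1u_{l_1}}\cdots T^g_{u_{l_{p-2}}u_{l_{p-1}}}\mathcal G^g_vT^g_{vu_{l_p}}T^g_{u_{l_p}u_{l_{p+1}}}\cdots T^g_{u_{l_{2(i-1)-1}}u_{l_{2(i-1)}}}\Big\{\prod_{j=2}^{i-1}h_j(\Delta_j)\Big[h_i\Big(x_1+\sum_{j=2}^{i}\Delta_j\Big)-h_i\Big(x_1+\sum_{j=2}^{i-1}\Delta_j\Big)\Big]\Big\}(x_1)\,dv.$$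 -/

import Mathlib

open MeasureTheory ProbabilityTheory Filter Topology
open scoped ENNReal

noncomputable section

namespace SetMarkov

/-! ### The set-indexed framework -/

/-- `𝒮` is a finite sub-semilattice of the class `𝒜`. -/
def IsFiniteSubsemilattice {X : Type*} (𝒜 𝒮 : Set (Set X)) : Prop :=
  𝒮 ⊆ 𝒜 ∧ 𝒮.Finite ∧ 𝒮.Nonempty ∧ ∀ A ∈ 𝒮, ∀ B ∈ 𝒮, A ∩ B ∈ 𝒮

/-- A semilattice `𝒜` of closed subsets of a compact Hausdorff space: closed under arbitrary
intersections, containing `∅` and the whole space, without disjoint non-empty members, and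
separable from above. -/
structure IndexingCollection (X : Type*) [TopologicalSpace X] [CompactSpace X] [T2Space X]
    [Nonempty X] where
  /-- the class `𝒜` -/
  sets : Set (Set X)
  isClosed : ∀ A ∈ sets, IsClosed A
  empty_mem : ∅ ∈ sets
  univ_mem : Set.univ ∈ sets
  sInter_mem : ∀ S ⊆ sets, ⋂₀ S ∈ sets
  inter_nonempty : ∀ A ∈ sets, ∀ B ∈ sets, A.Nonempty → B.Nonempty → (A ∩ B).Nonempty
  /-- separability from above: `g m` is the `m`-th approximation and `𝒜m m` the `m`-th finite
  sub-semilattice -/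
  separable : ∃ (g : ℕ → Set X → Set X) (𝒜m : ℕ → Set (Set X)),
    (∀ m, IsFiniteSubsemilattice sets (𝒜m m)) ∧ (∀ m, 𝒜m m ⊆ 𝒜m (m + 1)) ∧
    (∀ A ∈ sets, A = ⋂ m, g m A) ∧
    (∀ A ∈ sets, ∀ m, g (m + 1) A ⊆ g m A) ∧
    (∀ A ∈ sets, ∀ m, A ⊆ interior (g m A)) ∧
    (∀ A ∈ sets, ∀ m, ∃ S ⊆ 𝒜m m, g m A = ⋃₀ S) ∧
    (∀ m, ∀ S ⊆ sets, S.Nonempty → g m (⋂₀ S) = ⋂ A ∈ S, g m A) ∧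
    (∀ m, ∀ S ⊆ sets, ∀ S' ⊆ sets, S.Finite → S'.Finite → ⋃₀ S = ⋃₀ S' →
      ⋃ A ∈ S, g m A = ⋃ A ∈ S', g m A) ∧
    (∀ m, g m ∅ = ∅)

/-- `f` is increasing with values in the class `𝒞` on the interval `[s, e]`. -/
def IsFlow {X : Type*} (𝒞 : Set (Set X)) (s e : ℝ) (f : ℝ → Set X) : Prop :=
  (∀ r ∈ Set.Icc s e, f r ∈ 𝒞) ∧ MonotoneOn f (Set.Icc s e)

/-- Continuity of a flow on `[s, e]`, from the right and from the left. -/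
def IsContinuousFlow {X : Type*} [TopologicalSpace X] (𝒞 : Set (Set X)) (s e : ℝ)
    (f : ℝ → Set X) : Prop :=
  IsFlow 𝒞 s e f ∧
  ∀ r ∈ Set.Icc s e, ∀ q : ℕ → ℝ, (∀ m, q m ∈ Set.Icc s e) → Tendsto q atTop (𝓝 r) →
    (Antitone q → f r = ⋂ m, f (q m)) ∧ (Monotone q → f r = closure (⋃ m, f (q m)))

section Framework

variable {X : Type*} [TopologicalSpace X] [CompactSpace X] [T2Space X] [Nonempty X]

/-- The minimal set `∅' = ⋂ {A ∈ 𝒜 : A ≠ ∅}`. -/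
def IndexingCollection.minimalSet (𝒜 : IndexingCollection X) : Set X :=
  ⋂₀ {A | A ∈ 𝒜.sets ∧ A.Nonempty}

/-- The class `𝒜(u)` of finite unions of members of `𝒜`. -/
def IndexingCollection.finiteUnions (𝒜 : IndexingCollection X) : Set (Set X) :=
  {B | ∃ S ⊆ 𝒜.sets, S.Finite ∧ B = ⋃₀ S}

/-- `{A 0 = ∅', A 1, …, A n}` is a consistent ordering of the finite sub-semilattice `𝒮` (of
non-empty sets): `A 1` is the intersection of `𝒮`, the sets `A 1, …, A n` are distinct and exhaust
`𝒮`, and no set is numbered before one of its proper subsets from `𝒮`. -/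
structure IsConsistentOrdering (𝒜 : IndexingCollection X) (𝒮 : Set (Set X)) (n : ℕ)
    (A : ℕ → Set X) : Prop where
  semilattice : IsFiniteSubsemilattice 𝒜.sets 𝒮
  nonempty : ∀ B ∈ 𝒮, B.Nonempty
  zero : A 0 = 𝒜.minimalSet
  one : A 1 = ⋂₀ 𝒮
  bijOn : Set.BijOn A (Set.Icc 1 n) 𝒮
  consistent : ∀ i ∈ Set.Icc 1 n, ∀ B ∈ 𝒮, B ⊂ A i → ∃ j, 1 ≤ j ∧ j < i ∧ A j = B

/-- A simple flow on `[0, a]`: a continuous `𝒜(u)`-valued flow starting at `∅'` which is piecewise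
`𝒜`-valued. -/
def IsSimpleFlow (𝒜 : IndexingCollection X) (a : ℝ) (f : ℝ → Set X) : Prop :=
  IsContinuousFlow 𝒜.finiteUnions 0 a f ∧ f 0 = 𝒜.minimalSet ∧
  ∃ (n : ℕ) (t : ℕ → ℝ) (φ : ℕ → ℝ → Set X),
    t 0 = 0 ∧ t n = a ∧ StrictMonoOn t (Set.Icc 0 n) ∧
    ∀ i < n, IsFlow 𝒜.sets (t i) (t (i + 1)) (φ (i + 1)) ∧
      ∀ r ∈ Set.Icc (t i) (t (i + 1)),
        f r = (⋃ j ∈ Set.Icc 1 i, φ j (t j)) ∪ φ (i + 1) r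

/-- The simple flow `f` on `[0, a]`, with partition `0 = t 0 < t 1 < … < t n = a`, connects the
sets `A 0, …, A n` in this order: on `[t i, t (i+1)]` it is `A 0 ∪ … ∪ A i` together with a
continuous `𝒜`-valued flow which starts inside that union and ends at `A (i+1)`.
In particular `f (t i) = A 0 ∪ … ∪ A i`. -/
structure Connects (𝒜 : IndexingCollection X) (n : ℕ) (A : ℕ → Set X) (a : ℝ) (t : ℕ → ℝ)
    (f : ℝ → Set X) : Prop where
  simple : IsSimpleFlow 𝒜 a f
  t_zero : t 0 = 0
  t_last : t n = a
  t_strictMono : StrictMonoOn t (Set.Icc 0 n)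
  pieces : ∃ φ : ℕ → ℝ → Set X, ∀ i < n,
    IsContinuousFlow 𝒜.sets (t i) (t (i + 1)) (φ (i + 1)) ∧
    φ (i + 1) (t i) ⊆ ⋃ j ∈ Set.Icc 0 i, A j ∧
    φ (i + 1) (t (i + 1)) = A (i + 1) ∧
    ∀ r ∈ Set.Icc (t i) (t (i + 1)), f r = (⋃ j ∈ Set.Icc 0 i, A j) ∪ φ (i + 1) r

end Framework

/-! ### Bounded measurable functions, transition systems, semigroups and generators -/

/-- The bounded Borel functions `ℝ → ℝ`, as a subspace of the space of all bounded functions with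
the supremum norm. -/
def boundedMeasurable : Submodule ℝ (lp (fun _ : ℝ => ℝ) ∞) where
  carrier := {h | Measurable (fun x => h x)}
  add_mem' := by
    intro f g hf hg
    exact Measurable.add hf hg
  zero_mem' := by
    exact (measurable_const : Measurable fun _ : ℝ => (0 : ℝ))
  smul_mem' := by
    intro c f hf
    exact Measurable.const_mul hf c

/-- The Banach space `B(ℝ)` of bounded Borel functions `ℝ → ℝ` with the supremum norm. -/
def BR : Type := boundedMeasurable

instance : NormedAddCommGroup BR := inferInstanceAs (NormedAddCommGroup boundedMeasurable)

instance : NormedSpace ℝ BR := inferInstanceAs (NormedSpace ℝ boundedMeasurable)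

instance : CoeFun BR (fun _ => ℝ → ℝ) := ⟨fun h x => h.1 x⟩

theorem BR.measurable (h : BR) : Measurable (fun x => h x) := h.2

theorem BR.abs_le_norm (h : BR) (x : ℝ) : |h x| ≤ ‖h‖ :=
  lp.norm_apply_le_norm ENNReal.top_ne_zero h.1 x

theorem BR.ext_apply {h k : BR} (H : ∀ x, h x = k x) : h = k :=
  Subtype.ext (lp.ext (funext H))

/-- The element of `B(ℝ)` given by a bounded measurable function. -/
def BR.mk (φ : ℝ → ℝ) (hm : Measurable φ) (hb : ∃ C, ∀ x, |φ x| ≤ C) : BR :=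
  ⟨⟨φ, memℓp_infty (by
    obtain ⟨C, hC⟩ := hb
    exact ⟨C, by rintro _ ⟨x, rfl⟩; exact hC x⟩)⟩, hm⟩

/-- A one-dimensional transition system `(Q_{st})`, `0 ≤ s ≤ t ≤ a`, on `ℝ`. The kernels are
indexed by all pairs of reals for convenience; those outside the range `0 ≤ s ≤ t ≤ a` carry no
information. -/
structure TransitionSystem (a : ℝ) where
  /-- the transition probability `Q_{st}(x; dy)` -/
  Q : ℝ → ℝ → Kernel ℝ ℝ
  markov : ∀ s t, IsMarkovKernel (Q s t)
  self : ∀ s, 0 ≤ s → s ≤ a → ∀ x, Q s s x = Measure.dirac x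
  chapman : ∀ s r t, 0 ≤ s → s ≤ r → r ≤ t → t ≤ a →
    ∀ x, ∀ Γ : Set ℝ, MeasurableSet Γ → Q s t x Γ = ∫⁻ y, Q r t y Γ ∂(Q s r x)

namespace TransitionSystem

variable {a : ℝ} (P : TransitionSystem a)

/-- The operator `(T_{st} φ)(x) = ∫ φ(y) Q_{st}(x; dy)` on functions. -/
def apply (s t : ℝ) (φ : ℝ → ℝ) (x : ℝ) : ℝ := ∫ y, φ y ∂(P.Q s t x)

theorem measurable_apply (s t : ℝ) (h : BR) : Measurable (P.apply s t (fun x => h x)) := by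
  have := P.markov s t
  exact ((BR.measurable h).stronglyMeasurable.integral_kernel (κ := P.Q s t)).measurable

theorem abs_apply_le (s t : ℝ) (h : BR) (x : ℝ) : |P.apply s t (fun x => h x) x| ≤ ‖h‖ := by
  have := P.markov s t
  have := norm_integral_le_of_norm_le_const (μ := P.Q s t x) (f := fun y => h y) (C := ‖h‖)
    (Filter.Eventually.of_forall fun y => BR.abs_le_norm h y)
  simpa [apply] using this

theorem integrable (s t x : ℝ) (h : BR) : Integrable (fun y => h y) (P.Q s t x) := by
  have := P.markov s t
  exact Integrable.of_bound (BR.measurable h).aestronglyMeasurable ‖h‖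
    (Filter.Eventually.of_forall fun y => BR.abs_le_norm h y)

/-- The semigroup `T_{st} : B(ℝ) → B(ℝ)` associated with the transition system. -/
def T (s t : ℝ) : BR →ₗ[ℝ] BR where
  toFun h := BR.mk (P.apply s t (fun x => h x)) (P.measurable_apply s t h)
    ⟨‖h‖, P.abs_apply_le s t h⟩
  map_add' h k := by
    apply BR.ext_apply
    intro x
    exact integral_add (P.integrable s t x h) (P.integrable s t x k)
  map_smul' c h := by
    apply BR.ext_apply
    intro x
    exact integral_const_mul c _

/-- `k = lim_{r ↑ s} (T_{rs} h - h) / (s - r)` in `B(ℝ)`. -/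
def HasGenerator (s : ℝ) (h k : BR) : Prop :=
  Tendsto (fun r => (s - r)⁻¹ • (P.T r s h - h)) (𝓝[<] s) (𝓝 k)

variable {P} in
theorem HasGenerator.add {s : ℝ} {h h' k k' : BR} (H : P.HasGenerator s h k)
    (H' : P.HasGenerator s h' k') : P.HasGenerator s (h + h') (k + k') := by
  refine (Tendsto.add H H').congr fun r => ?_
  rw [map_add, ← smul_add, add_sub_add_comm]

variable {P} in
theorem HasGenerator.smul {s : ℝ} {h k : BR} (c : ℝ) (H : P.HasGenerator s h k) :
    P.HasGenerator s (c • h) (c • k) := by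
  refine (Tendsto.const_smul H c).congr fun r => ?_
  rw [map_smul, ← smul_sub, smul_comm]

variable {P} in
theorem HasGenerator.unique {s : ℝ} {h k k' : BR} (H : P.HasGenerator s h k)
    (H' : P.HasGenerator s h k') : k = k' :=
  tendsto_nhds_unique H H'

theorem hasGenerator_zero (s : ℝ) : P.HasGenerator s 0 0 := by
  refine tendsto_const_nhds.congr fun r => ?_
  rw [map_zero, sub_zero, smul_zero]

/-- The subspace of all `h` for which the limit defining the generator at time `s` exists. -/
def generatorDomain (s : ℝ) : Submodule ℝ BR where
  carrier := {h | ∃ k : BR, P.HasGenerator s h k}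
  add_mem' := fun ⟨_, hk⟩ ⟨_, hk'⟩ => ⟨_, hk.add hk'⟩
  zero_mem' := ⟨0, P.hasGenerator_zero s⟩
  smul_mem' := fun c _ ⟨_, hk⟩ => ⟨_, hk.smul c⟩

theorem exists_hasGenerator {s : ℝ} (h : P.generatorDomain s) :
    ∃ k : BR, P.HasGenerator s h k := h.2

/-- The (backward) generator at time `s`: `𝒢_s h = lim_{r ↑ s} (T_{rs} h - h) / (s - r)` in
`B(ℝ)`, defined on the subspace of all `h` for which the limit exists. -/
def generator (s : ℝ) : BR →ₗ.[ℝ] BR where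
  domain := P.generatorDomain s
  toFun :=
    { toFun := fun h => (P.exists_hasGenerator h).choose
      map_add' := fun h h' => (P.exists_hasGenerator (h + h')).choose_spec.unique
        ((P.exists_hasGenerator h).choose_spec.add (P.exists_hasGenerator h').choose_spec)
      map_smul' := fun c h => (P.exists_hasGenerator (c • h)).choose_spec.unique
        ((P.exists_hasGenerator h).choose_spec.smul c) }

/-- The standing regularity assumption on the semigroup and a common subspace `D`: `D` is
invariant, for `h ∈ D` the function `T_{st} h` is strongly continuously differentiable in each of
the variables `s` and `t`, and the backward and the forward generator coincide on `D`,
i.e. `-(∂⁻/∂r) T_{rs} h |_{r = s} = (∂⁺/∂t) T_{st} h |_{t = s}`. -/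
structure IsRegularOn (D : Submodule ℝ BR) : Prop where
  invariant : ∀ s t, 0 ≤ s → s ≤ t → t ≤ a → ∀ h ∈ D, P.T s t h ∈ D
  contDiff_left : ∀ t, 0 ≤ t → t ≤ a → ∀ h ∈ D,
    ContDiffOn ℝ 1 (fun s => P.T s t h) (Set.Icc 0 t)
  contDiff_right : ∀ s, 0 ≤ s → s ≤ a → ∀ h ∈ D,
    ContDiffOn ℝ 1 (fun t => P.T s t h) (Set.Icc s a)
  backward_eq_forward : ∀ s, 0 < s → s < a → ∀ h ∈ D,
    -derivWithin (fun r => P.T r s h) (Set.Icc 0 s) s =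
      derivWithin (fun t => P.T s t h) (Set.Icc s a) s

/-- The iterated integral
`T_{u_k u_{l₁}} T_{u_{l₁} u_{l₂}} ⋯ T_{u_{l_{m-1}} u_{l_m}} [H]`, for the list `[l₁, …, l_m]`.
Here `H` is a function of variables `y_l`, `l ∈ ℕ`; the operator `T_{u_{l'} u_l}` integrates over
the variable `y_l` with respect to `Q_{u_{l'} u_l}(y_{l'}; dy_l)`, and the variables which are not
in the list keep the values given by `y`. -/
def iter (u : ℕ → ℝ) : ℕ → List ℕ → ((ℕ → ℝ) → ℝ) → (ℕ → ℝ) → ℝ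
  | _, [], H, y => H y
  | k, l :: ls, H, y =>
      ∫ z, iter u l ls H (Function.update y l z) ∂(P.Q (u k) (u l) (y k))

end TransitionSystem

/-- The function `φ : ℝ → ℝ` is (an element of `B(ℝ)` and) in the domain of `G`. -/
def InDomain (G : BR →ₗ.[ℝ] BR) (φ : ℝ → ℝ) : Prop :=
  ∃ h : G.domain, (fun x => (h : BR) x) = φ

open Classical in
/-- `G φ` for a function `φ : ℝ → ℝ` in the domain of `G` (and `0` otherwise). -/
def genApply (G : BR →ₗ.[ℝ] BR) (φ : ℝ → ℝ) (x : ℝ) : ℝ :=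
  if H : InDomain G φ then (G H.choose) x else 0

/-! ### The two conditions -/

/-- Condition (a): the distribution of the initial value and the increments of the first process
along its partition, computed from `Qf` and `μ`, is that of the permuted increments of the
second one, computed from `Qg` and `μ`. -/
def IntegralCondition {a b : ℝ} (Pf : TransitionSystem a) (Pg : TransitionSystem b)
    (μ : Measure ℝ) (n : ℕ) (π : ℕ → ℕ) (t u : ℕ → ℝ) : Prop :=
  ∀ Γ : ℕ → Set ℝ, (∀ i, MeasurableSet (Γ i)) →
    ∫ x₀, Pf.iter t 0 (List.range' 1 n)
      (fun x => (Γ 0).indicator 1 (x 0) * (Γ 1).indicator 1 (x 1) *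
        ∏ i ∈ Finset.Icc 2 n, (Γ i).indicator 1 (x i - x (i - 1))) (fun _ => x₀) ∂μ =
    ∫ y₀, Pg.iter u 0 (List.range' 1 n)
      (fun y => (Γ 0).indicator 1 (y 0) * (Γ 1).indicator 1 (y 1) *
        ∏ i ∈ Finset.Icc 2 n, (Γ i).indicator 1 (y (π i) - y (π i - 1))) (fun _ => y₀) ∂μ

section Generators

variable (π : ℕ → ℕ)

/-- The increasing ordering `l_1 ≤ … ≤ l_{2(i-1)}` of the values
`π(2)-1, π(2), …, π(i)-1, π(i)`. -/
def levels (i : ℕ) : List ℕ :=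
  ((List.range' 2 (i - 1)).flatMap fun j => [π j - 1, π j]).insertionSort (· ≤ ·)

/-- The index `p` with `l_{p-1} = π(i)-1` and `l_p = π(i)`: the position (counted from `1`) of the
first occurrence of `π(i)`. -/
def pIndex (i : ℕ) : ℕ := (levels π i).idxOf (π i) + 1

/-- The list `l_1, …, l_{p-2}`. -/
def before (i : ℕ) : List ℕ := (levels π i).take (pIndex π i - 2)

/-- The list `l_{p+1}, …, l_{2(i-1)}`. -/
def after (i : ℕ) : List ℕ := (levels π i).drop (pIndex π i)

/-- The sum `∑_{j=2}^{m} (y_{π(j)} - y_{π(j)-1})`. -/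
def incSum (m : ℕ) (y : ℕ → ℝ) : ℝ := ∑ j ∈ Finset.Icc 2 m, (y (π j) - y (π j - 1))

/-- The product `∏_{j=2}^{m} h_j(y_{π(j)} - y_{π(j)-1})`. -/
def incProd (h : ℕ → BR) (m : ℕ) (y : ℕ → ℝ) : ℝ :=
  ∏ j ∈ Finset.Icc 2 m, h j (y (π j) - y (π j - 1))

/-- The function in brackets on the right-hand side: that of (b1) if `p = 2(i-1)` and that of (b2)
if `p < 2(i-1)`. -/
def rhsBracket (h : ℕ → BR) (i : ℕ) (x₁ : ℝ) (y : ℕ → ℝ) : ℝ :=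
  if pIndex π i = 2 * (i - 1) then
    incProd π h (i - 1) y * h i (x₁ + incSum π i y)
  else
    incProd π h (i - 1) y * (h i (x₁ + incSum π i y) - h i (x₁ + incSum π (i - 1) y))

variable {a b : ℝ} (Pf : TransitionSystem a) (Pg : TransitionSystem b) (t u : ℕ → ℝ)

/-- The integrand (in `w`) on the left-hand side of (b1) and (b2):
`T^g ⋯ T^g [∏_{j=2}^{i-1} h_j(y_{π(j)} - y_{π(j)-1})
  (𝒢^f_w T^f_{w t_i} h_i)(x₁ + ∑_{j=2}^{i-1} (y_{π(j)} - y_{π(j)-1}))](x₁)`, where the product of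
operators runs through `u_1, u_{l_1}, …, u_{l_{p-2}}, u_{l_{p+1}}, …, u_{l_{2(i-1)}}` (the part
after `l_{p-2}` being absent if `p = 2(i-1)`). -/
def lhsIntegrand (h : ℕ → BR) (i : ℕ) (x₁ w : ℝ) : ℝ :=
  Pg.iter u 1 (before π i ++ after π i)
    (fun y => incProd π h (i - 1) y *
      genApply (Pf.generator w) (Pf.apply w (t i) (fun x => h i x)) (x₁ + incSum π (i - 1) y))
    (fun _ => x₁)

/-- The function of `z` to which `𝒢^g_v` is applied on the right-hand side:
`T^g_{v u_{l_p}} T^g_{u_{l_p} u_{l_{p+1}}} ⋯ T^g_{u_{l_{2(i-1)-1}} u_{l_{2(i-1)}}}` applied to the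
bracket, for fixed `x₁` and fixed values `y_l` of the other variables. -/
def rhsInner (h : ℕ → BR) (i : ℕ) (x₁ v : ℝ) (y : ℕ → ℝ) (z : ℝ) : ℝ :=
  Pg.apply v (u (π i))
    (fun z' => Pg.iter u (π i) (after π i) (rhsBracket π h i x₁) (Function.update y (π i) z')) z

/-- The integrand (in `v`) on the right-hand side of (b1) and (b2):
`T^g_{u_1 u_{l_1}} ⋯ T^g_{u_{l_{p-2}} u_{l_{p-1}}} 𝒢^g_v T^g_{v u_{l_p}} ⋯ [bracket](x₁)`. -/
def rhsIntegrand (h : ℕ → BR) (i : ℕ) (x₁ v : ℝ) : ℝ :=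
  Pg.iter u 1 (before π i ++ [π i - 1])
    (fun y => genApply (Pg.generator v) (rhsInner π Pg u h i x₁ v y) (y (π i - 1)))
    (fun _ => x₁)

/-- The two sides of the identities (b1), (b2) for the index `i` are defined: the functions to
which the generators are applied are in their domains, and the integrals over the time intervals
exist. -/
def IdentityDefined (h : ℕ → BR) (i : ℕ) (x₁ : ℝ) : Prop :=
  (∀ w ∈ Set.Icc (t (i - 1)) (t i),
    InDomain (Pf.generator w) (Pf.apply w (t i) (fun x => h i x))) ∧
  (∀ v ∈ Set.Icc (u (π i - 1)) (u (π i)), ∀ y : ℕ → ℝ,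
    InDomain (Pg.generator v) (rhsInner π Pg u h i x₁ v y)) ∧
  IntervalIntegrable (lhsIntegrand π Pf Pg t u h i x₁) volume (t (i - 1)) (t i) ∧
  IntervalIntegrable (rhsIntegrand π Pg u h i x₁) volume (u (π i - 1)) (u (π i))

/-- Condition (b): the identity (b1) or (b2), for each `i = 2, …, n`, all `h_2, …, h_i ∈ D` and
`μ_{t_1}^f`-almost all `x₁`, where `μ_{t_1}^f = ∫ Q^f_{0 t_1}(x; ·) μ(dx)`. -/
def GeneratorCondition (D : Submodule ℝ BR) (μ : Measure ℝ) (n : ℕ) : Prop :=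
  ∀ i, 2 ≤ i → i ≤ n → ∀ h : ℕ → BR, (∀ j, 2 ≤ j → j ≤ i → h j ∈ D) →
    ∀ᵐ x₁ ∂(μ.bind (Pf.Q 0 (t 1))),
      ∫ w in (t (i - 1))..(t i), lhsIntegrand π Pf Pg t u h i x₁ w =
        ∫ v in (u (π i - 1))..(u (π i)), rhsIntegrand π Pg u h i x₁ v

end Generators

end SetMarkov

end

/-!
# Why the generator identities characterise the equality of the laws of the increments

**Regularity on a dense subspace.** The translates `z ↦ h (x + z - y)` of an element `h` of `D`, to
which the generators of the second process are applied, need not lie in `D`. They lie in the domains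
of the generators nevertheless, because these are bounded operators on all of `B(ℝ)`. The space
`B(ℝ)` contains all indicators of Borel sets, and as in Lotz's theorem on semigroups on `L^∞`, this
forces `Q_{rs}(x; {x}ᶜ) ≤ L (s - r)` uniformly in `x`, `r` and `s`
(`IsRegularOn.exists_leave_le`). Otherwise there is a sequence of transitions violating the bound,
starting at points `x_k`. By a weak form of Rosenthal's lemma one may pass to infinitely many `k` for
which at most half of the mass that leaves `x_k` goes to other points `x_j`. The indicator function
of the set of these points, and every function uniformly close to it, detects the large rates, but
functions `T_{s t} h` with `h ∈ D` are among these and have bounded difference quotients. From the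
bound on the rates, the backward equation
`∫_s^t 𝒢_v T_{vt} φ dv = T_{st} φ - φ` extends from `D` to all `φ ∈ B(ℝ)`
(`IsRegularOn.exists_backwardEquation`).

**The generator identities.** An iterated integral along a sorted list of times is the expectation
of a functional of the path, and by the Chapman–Kolmogorov equations only the variables on which
the functional depends matter (`iter_eq_iter_range'`). Together with Fubini's theorem and the
backward equation this evaluates both sides. With `ξ_m = x₁ + ∑_{j=2}^m Δ_j`, the left-hand side is
the expectation, for the second process started from `x₁`, of
`∏_{j<i} h_j(Δ_j) (T^f_{t_{i-1} t_i} h_i - h_i)(ξ_{i-1})`, and the right-hand side is the expectation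
of `∏_{j<i} h_j(Δ_j) (h_i(ξ_i) - h_i(ξ_{i-1}))`; if `π(i)` is the last
level, the subtracted term arises from the backward equation, and otherwise it is part of the
bracket and makes the contribution of the term `-φ` in the backward equation vanish. So the identity
for the index `i` says that `ξ_i` is predicted from the earlier partial sums by the kernel
`Q^f_{t_{i-1} t_i}` (`integral_lhs_eq_rhs_iff`).

**The equivalence.** The integral condition says that `(y_0, ξ_1, …, ξ_n)` has the law of the first process
at the times `0, t_1, …, t_n`. This law is determined by its first two coordinates and the one-step
predictions (`sameIncrements_iff`), the functions in `D` being sufficient as test functions by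
density (`predicts_of_dense`), and conditioning on the initial values gives the statement for almost
all `x₁` (`ae_pathMean_eq_iff`).
-/

noncomputable section

namespace SetMarkov

/-! ### The Banach space of bounded Borel functions -/

@[simp] theorem BR.mk_apply (φ : ℝ → ℝ) (hm : Measurable φ) (hb : ∃ C, ∀ x, |φ x| ≤ C) (x : ℝ) :
    BR.mk φ hm hb x = φ x := rfl

@[simp] theorem BR.sub_apply (h k : BR) (x : ℝ) : (h - k) x = h x - k x := rfl

theorem BR.norm_le {h : BR} {C : ℝ} (hC : 0 ≤ C) (H : ∀ x, |h x| ≤ C) : ‖h‖ ≤ C :=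
  lp.norm_le_of_forall_le hC H

theorem BR.abs_sub_le (h k : BR) (x : ℝ) : |h x - k x| ≤ ‖h - k‖ :=
  BR.abs_le_norm (h - k) x

/-- Evaluation at a point, as a continuous linear functional on `B(ℝ)`. -/
def BR.eval (x : ℝ) : BR →L[ℝ] ℝ :=
  LinearMap.mkContinuous
    { toFun := fun h => h x
      map_add' := fun _ _ => rfl
      map_smul' := fun _ _ => rfl } 1 (fun h => by rw [one_mul]; exact BR.abs_le_norm h x)

theorem BR.tendsto_apply {ι : Type*} {l : Filter ι} {F : ι → BR} {k : BR}
    (H : Tendsto F l (𝓝 k)) (x : ℝ) : Tendsto (fun i => F i x) l (𝓝 (k x)) :=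
  ((BR.eval x).continuous.tendsto k).comp H

instance : CompleteSpace BR := by
  have hcl : IsClosed (boundedMeasurable : Set (lp (fun _ : ℝ => ℝ) ∞)) := by
    refine IsSeqClosed.isClosed fun F k hF hk => ?_
    have hpt : ∀ x : ℝ, Tendsto (fun i => F i x) atTop (𝓝 (k x)) := fun x => by
      rw [tendsto_iff_norm_sub_tendsto_zero] at hk ⊢
      exact squeeze_zero (fun _ => norm_nonneg _)
        (fun i => lp.norm_apply_le_norm ENNReal.top_ne_zero (F i - k) x) hk
    exact measurable_of_tendsto_metrizable (fun i => hF i) (tendsto_pi_nhds.2 hpt)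
  exact hcl.isComplete.completeSpace_coe

/-- The indicator function of a Borel set, as an element of `B(ℝ)`. -/
def BR.ind (Γ : Set ℝ) (hΓ : MeasurableSet Γ) : BR :=
  BR.mk (Γ.indicator 1) (measurable_one.indicator hΓ)
    ⟨1, fun x => by by_cases h : x ∈ Γ <;> simp [h]⟩

/-! ### Elementary properties of transition systems -/

namespace TransitionSystem

variable {a : ℝ} (P : TransitionSystem a)

instance (s t : ℝ) : IsMarkovKernel (P.Q s t) := P.markov s t

theorem T_apply (s t : ℝ) (h : BR) (x : ℝ) : P.T s t h x = ∫ y, h y ∂(P.Q s t x) := rfl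

theorem norm_T_le (s t : ℝ) (h : BR) : ‖P.T s t h‖ ≤ ‖h‖ :=
  BR.norm_le (norm_nonneg _) (P.abs_apply_le s t h)

theorem Q_eq_bind {s r t : ℝ} (hs : 0 ≤ s) (hsr : s ≤ r) (hrt : r ≤ t) (ht : t ≤ a) (x : ℝ) :
    P.Q s t x = (P.Q s r x).bind (P.Q r t) := by
  ext Γ hΓ
  rw [P.chapman s r t hs hsr hrt ht x Γ hΓ, Measure.bind_apply hΓ (P.Q r t).aemeasurable]

theorem integral_chapman {s r t : ℝ} (hs : 0 ≤ s) (hsr : s ≤ r) (hrt : r ≤ t) (ht : t ≤ a)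
    (x : ℝ) {φ : ℝ → ℝ} (hφ : Measurable φ) {C : ℝ} (hC : ∀ z, |φ z| ≤ C) :
    ∫ z, φ z ∂(P.Q s t x) = ∫ y, ∫ z, φ z ∂(P.Q r t y) ∂(P.Q s r x) := by
  have h1 : P.Q s t x = (P.Q r t ∘ₖ P.Q s r) x := by
    rw [P.Q_eq_bind hs hsr hrt ht, Kernel.comp_apply]
  have h2 : Integrable φ (P.Q s t x) :=
    Integrable.of_bound hφ.aestronglyMeasurable C (Eventually.of_forall hC)
  rw [h1] at h2 ⊢
  exact Kernel.integral_comp h2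

theorem T_comp {s r t : ℝ} (hs : 0 ≤ s) (hsr : s ≤ r) (hrt : r ≤ t) (ht : t ≤ a) (h : BR) :
    P.T s r (P.T r t h) = P.T s t h :=
  BR.ext_apply fun x =>
    (P.integral_chapman hs hsr hrt ht x (BR.measurable h) (BR.abs_le_norm h)).symm

theorem T_self {s : ℝ} (hs : 0 ≤ s) (hsa : s ≤ a) (h : BR) : P.T s s h = h := by
  refine BR.ext_apply fun x => ?_
  rw [T_apply, P.self s hs hsa, integral_dirac' _ _ (BR.measurable h).stronglyMeasurable]

/-- The probability that the transition from time `s` to time `t` leaves the starting point. -/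
def leave (s t x : ℝ) : ℝ := (P.Q s t x).real {x}ᶜ

theorem norm_T_sub_le {s t L : ℝ} (hL : 0 ≤ L) (H : ∀ x, P.leave s t x ≤ L) (h : BR) :
    ‖P.T s t h - h‖ ≤ 2 * L * ‖h‖ := by
  refine BR.norm_le (by positivity) fun x => ?_
  have h1 : P.T s t h x - h x = ∫ y in {x}ᶜ, (h y - h x) ∂(P.Q s t x) := by
    have h2 : P.T s t h x - h x = ∫ y, (h y - h x) ∂(P.Q s t x) := by
      rw [integral_sub (P.integrable s t x h) (integrable_const _)]
      simp [T_apply]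
    rw [h2, setIntegral_eq_integral_of_forall_compl_eq_zero]
    intro y hy
    simp only [Set.mem_compl_iff, not_not, Set.mem_singleton_iff] at hy
    rw [hy, sub_self]
  rw [BR.sub_apply, h1]
  have h3 := norm_setIntegral_le_of_norm_le_const (μ := P.Q s t x) (s := {x}ᶜ)
    (f := fun y => h y - h x) (C := 2 * ‖h‖) (measure_lt_top _ _) (fun y _ => by
      have := BR.abs_le_norm h y
      have := BR.abs_le_norm h x
      rw [Real.norm_eq_abs]
      rw [abs_le] at *
      constructor <;> linarith)
  rw [Real.norm_eq_abs] at h3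
  refine h3.trans ?_
  have := H x
  have h4 : 2 * ‖h‖ * P.leave s t x ≤ 2 * ‖h‖ * L :=
    mul_le_mul_of_nonneg_left this (by positivity)
  rw [leave] at h4
  linarith

end TransitionSystem

end SetMarkov

namespace SetMarkov

/-! ### Regularity on a dense subspace forces bounded jump rates -/

/-- A weak form of Rosenthal's disjointification lemma. In the case where the points are distinct,
the index set is cut into infinitely many infinite pieces: either some piece works, or picking one
bad index in each piece gives a set that works, because each measure already has more than half of
its mass in its own piece. -/
theorem exists_infinite_measureReal_image_sdiff_le {E : Type*} [MeasurableSpace E]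
    [MeasurableSingletonClass E] (x : ℕ → E) (ν : ℕ → Measure E) [∀ k, IsFiniteMeasure (ν k)] :
    ∃ N : Set ℕ, N.Infinite ∧
      ∀ k ∈ N, (ν k).real (x '' N \ {x k}) ≤ 1 / 2 * (ν k).real {x k}ᶜ := by
  classical
  by_cases hfin : (Set.range x).Finite
  · have : Finite (Set.range x) := hfin
    obtain ⟨y, hy⟩ := Finite.exists_infinite_fiber (Set.rangeFactorization x)
    refine ⟨Set.rangeFactorization x ⁻¹' {y}, Set.infinite_coe_iff.1 hy, fun k hk => ?_⟩
    have hval : ∀ m ∈ Set.rangeFactorization x ⁻¹' {y}, x m = y := fun m hm =>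
      congrArg Subtype.val hm
    have : x '' (Set.rangeFactorization x ⁻¹' {y}) \ {x k} = ∅ := by
      rw [Set.sdiff_eq_empty]
      rintro _ ⟨m, hm, rfl⟩
      rw [Set.mem_singleton_iff, hval m hm, hval k hk]
    rw [this, measureReal_empty]
    have := measureReal_nonneg (μ := ν k) (s := {x k}ᶜ)
    linarith
  · let e := Set.Infinite.natEmbedding _ hfin
    have hκ' : ∀ j, ∃ k, x k = e j := fun j => (e j).2
    choose κ hκ using hκ'
    have hinj : ∀ i j, x (κ i) = x (κ j) → i = j := fun i j h => by
      rw [hκ, hκ] at h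
      exact e.injective (Subtype.ext h)
    let M : ℕ → Set ℕ := fun i => Set.range fun j => κ (Nat.pair i j)
    by_cases H : ∃ i, ∀ k ∈ M i, (ν k).real (x '' M i \ {x k}) ≤ 1 / 2 * (ν k).real {x k}ᶜ
    · obtain ⟨i, hi⟩ := H
      refine ⟨M i, Set.infinite_range_of_injective fun j j' h => ?_, hi⟩
      exact (Nat.pair_eq_pair.1 (hinj _ _ (congrArg x h))).2
    · push Not at H
      choose k hkM hk using H
      choose m hm using hkM
      simp only at hm
      refine ⟨Set.range k, Set.infinite_range_of_injective fun i i' h => ?_, ?_⟩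
      · rw [← hm, ← hm] at h
        exact (Nat.pair_eq_pair.1 (hinj _ _ (congrArg x h))).1
      · rintro _ ⟨i, rfl⟩
        have hdisj : Disjoint (x '' Set.range k \ {x (k i)}) (x '' M i \ {x (k i)}) := by
          rw [Set.disjoint_left]
          rintro _ ⟨⟨_, ⟨i', rfl⟩, rfl⟩, hne⟩ ⟨⟨_, ⟨j, rfl⟩, hj⟩, -⟩
          apply hne
          rw [← hm i'] at hj
          have := (Nat.pair_eq_pair.1 (hinj _ _ hj)).1
          rw [Set.mem_singleton_iff, this]
        have hmeas : MeasurableSet (x '' M i \ {x (k i)}) :=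
          (((Set.countable_range _).image x).measurableSet).diff (measurableSet_singleton _)
        have h1 := measureReal_union (μ := ν (k i)) hdisj hmeas
        have h2 : (ν (k i)).real (x '' Set.range k \ {x (k i)} ∪ x '' M i \ {x (k i)}) ≤
            (ν (k i)).real {x (k i)}ᶜ := by
          refine measureReal_mono ?_
          rintro y (⟨-, hy⟩ | ⟨-, hy⟩) <;> exact hy
        have := hk i
        linarith

/-- If probability measures `ν k` put a non-negligible mass away from the points `x k`, then a
single indicator function `φ` detects this for infinitely many `k`, and so does every function
which is uniformly close to `φ`. -/
theorem exists_detecting_function (x : ℕ → ℝ) (ν : ℕ → Measure ℝ)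
    [∀ k, IsProbabilityMeasure (ν k)] :
    ∃ φ : BR, ∃ᶠ k in atTop, ∀ g : BR, ‖g - φ‖ ≤ 1 / 8 →
      (ν k).real {x k}ᶜ ≤ 4 * |∫ y, g y ∂(ν k) - g (x k)| := by
  obtain ⟨N, hN, hNk⟩ := exists_infinite_measureReal_image_sdiff_le x ν
  have hΓ : MeasurableSet (x '' N) := ((Set.to_countable N).image x).measurableSet
  refine ⟨BR.ind (x '' N) hΓ, (Nat.frequently_atTop_iff_infinite.2 hN).mono fun k hk g hg => ?_⟩
  have hg1 : ∀ y, |g y - (x '' N).indicator 1 y| ≤ 1 / 8 := fun y =>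
    (BR.abs_sub_le g (BR.ind (x '' N) hΓ) y).trans hg
  have hxk : x k ∈ x '' N := ⟨k, hk, rfl⟩
  have hgk := hg1 (x k)
  simp only [hxk, Set.indicator_of_mem, Pi.one_apply] at hgk
  have hint : Integrable (fun y => g y) (ν k) :=
    Integrable.of_bound (BR.measurable g).aestronglyMeasurable ‖g‖
      (Eventually.of_forall fun y => BR.abs_le_norm g y)
  set A := x '' N \ {x k} with hA
  have hAm : MeasurableSet A := hΓ.diff (measurableSet_singleton _)
  -- the lower bound is `3/4` off `Γ`, and `-1/4` on `Γ` without the point `x k`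
  have hlow : ∫ y, ((x '' N)ᶜ.indicator (fun _ => (3 / 4 : ℝ)) y
      + A.indicator (fun _ => (-1 / 4 : ℝ)) y) ∂(ν k) ≤ ∫ y, (g (x k) - g y) ∂(ν k) := by
    refine integral_mono ?_ ((integrable_const _).sub hint) fun y => ?_
    · exact ((integrable_const _).indicator hΓ.compl).add ((integrable_const _).indicator hAm)
    · have hgy := hg1 y
      rw [abs_le] at hgy hgk
      by_cases hy : y ∈ x '' N
      · by_cases hyk : y = x k
        · subst hyk
          simp [hA, hxk]
        · have hyA : y ∈ A := ⟨hy, hyk⟩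
          have hyc : y ∉ (x '' N)ᶜ := fun h => h hy
          simp only [hy, hyA, hyc, Set.indicator_of_mem, Set.indicator_of_notMem,
            not_false_eq_true, Pi.one_apply] at hgy ⊢
          linarith
      · have hyA : y ∉ A := fun h => hy h.1
        have hyc : y ∈ (x '' N)ᶜ := hy
        simp only [hy, hyA, hyc, Set.indicator_of_mem, Set.indicator_of_notMem,
            not_false_eq_true] at hgy ⊢
        linarith
  rw [integral_add ((integrable_const _).indicator hΓ.compl) ((integrable_const _).indicator hAm),
    integral_indicator_const _ hΓ.compl, integral_indicator_const _ hAm,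
    integral_sub (integrable_const _) hint] at hlow
  simp only [integral_const, probReal_univ, smul_eq_mul, one_mul] at hlow
  have hsplit : (ν k).real {x k}ᶜ = (ν k).real (x '' N)ᶜ + (ν k).real A := by
    rw [← measureReal_union _ hAm]
    · congr 1
      ext y
      simp only [hA, Set.mem_compl_iff, Set.mem_singleton_iff, Set.mem_union, Set.mem_sdiff]
      constructor
      · intro h; by_cases hy : y ∈ x '' N
        · exact Or.inr ⟨hy, h⟩
        · exact Or.inl hy
      · rintro (h | h)
        · rintro rfl; exact h hxk
        · exact h.2
    · exact Set.disjoint_left.2 fun y hy hy' => hy hy'.1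
  have := hNk k hk
  have hab := neg_abs_le (∫ y, g y ∂(ν k) - g (x k))
  linarith

namespace TransitionSystem

variable {a : ℝ} {P : TransitionSystem a} {D : Submodule ℝ BR}

theorem IsRegularOn.exists_lipschitz (hP : P.IsRegularOn D) {t : ℝ} (ht : 0 ≤ t) (hta : t ≤ a)
    {h : BR} (hh : h ∈ D) :
    ∃ C, ∀ r ∈ Set.Icc 0 t, ∀ s ∈ Set.Icc 0 t, ‖P.T r t h - P.T s t h‖ ≤ C * |r - s| := by
  obtain ⟨K, hK⟩ := (hP.contDiff_left t ht hta h hh).exists_lipschitzOnWith (by simp)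
    (convex_Icc 0 t) isCompact_Icc
  refine ⟨K, fun r hr s hs => ?_⟩
  have := hK.dist_le_mul r hr s hs
  rwa [dist_eq_norm, Real.dist_eq] at this

/-- Close to a time `s₀`, the elements of `D` are moved little by the operators `T_{vt}` with a
suitable fixed `t ≥ s₀`. -/
theorem IsRegularOn.exists_eventually_norm_sub_le (hP : P.IsRegularOn D) {s₀ : ℝ}
    (hs₀ : s₀ ∈ Set.Icc 0 a) {h : BR} (hh : h ∈ D) {ε : ℝ} (hε : 0 < ε) :
    ∃ t ∈ Set.Icc s₀ a, ∀ᶠ v in 𝓝[Set.Icc 0 a] s₀, v ≤ t ∧ ‖P.T v t h - h‖ ≤ ε := by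
  -- left continuity at a fixed end point `t`, given an estimate at time `s₀`
  have key : ∀ t ∈ Set.Icc s₀ a, ‖P.T s₀ t h - h‖ ≤ ε / 2 →
      (∀ᶠ v in 𝓝[Set.Icc 0 a] s₀, v ≤ t) →
      ∀ᶠ v in 𝓝[Set.Icc 0 a] s₀, v ≤ t ∧ ‖P.T v t h - h‖ ≤ ε := by
    intro t ht h1 h2
    obtain ⟨C, hC⟩ := hP.exists_lipschitz (hs₀.1.trans ht.1) ht.2 hh
    have h3 : Tendsto (fun v => C * |v - s₀|) (𝓝[Set.Icc 0 a] s₀) (𝓝 0) := by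
      have : Continuous fun v : ℝ => C * |v - s₀| := by fun_prop
      have h4 := this.tendsto s₀
      simp only [sub_self, abs_zero, mul_zero] at h4
      exact h4.mono_left nhdsWithin_le_nhds
    filter_upwards [h2, h3.eventually (gt_mem_nhds (half_pos hε)), self_mem_nhdsWithin]
      with v hv hv' hva
    refine ⟨hv, ?_⟩
    have h5 := hC v ⟨hva.1, hv⟩ s₀ ⟨hs₀.1, ht.1⟩
    calc ‖P.T v t h - h‖ = ‖(P.T v t h - P.T s₀ t h) + (P.T s₀ t h - h)‖ := by abel_nf
      _ ≤ _ := norm_add_le _ _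
      _ ≤ ε := by linarith
  rcases hs₀.2.eq_or_lt with rfl | hlt
  · refine ⟨s₀, ⟨le_rfl, le_rfl⟩, key s₀ ⟨le_rfl, le_rfl⟩ ?_ ?_⟩
    · rw [P.T_self hs₀.1 le_rfl, sub_self, norm_zero]
      positivity
    · filter_upwards [self_mem_nhdsWithin] with v hv using hv.2
  · have hcont := (hP.contDiff_right s₀ hs₀.1 hs₀.2 h hh).continuousOn s₀ ⟨le_rfl, hs₀.2⟩
    have h1 : Tendsto (fun t => ‖P.T s₀ t h - h‖) (𝓝[Set.Icc s₀ a] s₀) (𝓝 0) := by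
      have := (hcont.sub_const h).norm
      beta_reduce at this
      rwa [P.T_self hs₀.1 hs₀.2, sub_self, norm_zero] at this
    have h2 : ∀ᶠ t in 𝓝[>] s₀, t ∈ Set.Icc s₀ a :=
      mem_of_superset (Ioo_mem_nhdsGT hlt) fun t ht => ⟨ht.1.le, ht.2.le⟩
    have h3 : 𝓝[>] s₀ ≤ 𝓝[Set.Icc s₀ a] s₀ :=
      nhdsWithin_le_of_mem h2
    obtain ⟨t, ⟨ht, ht'⟩, htgt⟩ := ((h2.and ((h1.mono_left h3).eventually
      (gt_mem_nhds (half_pos hε)))).and self_mem_nhdsWithin).exists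
    refine ⟨t, ht, key t ht ht'.le ?_⟩
    exact nhdsWithin_le_nhds (Iic_mem_nhds htgt)

/-- On the space of all bounded Borel functions regularity is very restrictive (as in Lotz's
theorem on semigroups on `L^∞`): the rates at which the system leaves its current state are
bounded, uniformly in the state and in time. -/
theorem IsRegularOn.exists_leave_le (hP : P.IsRegularOn D) (hD : Dense (D : Set BR)) :
    ∃ L, 0 ≤ L ∧ ∀ r s, 0 ≤ r → r ≤ s → s ≤ a → ∀ x, P.leave r s x ≤ L * (s - r) := by
  by_contra! H
  have H' : ∀ k : ℕ, ∃ r s x, 0 ≤ r ∧ r ≤ s ∧ s ≤ a ∧ k * (s - r) < P.leave r s x := fun k => by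
    obtain ⟨r, s, h1, h2, h3, x, h4⟩ := H k k.cast_nonneg
    exact ⟨r, s, x, h1, h2, h3, h4⟩
  choose r s x hr hrs hsa hlt using H'
  obtain ⟨s₀, hs₀, σ, hσ, hlim⟩ := isCompact_Icc.tendsto_subseq
    (fun k => (⟨(hr k).trans (hrs k), hsa k⟩ : s k ∈ Set.Icc 0 a))
  obtain ⟨φ, hφ⟩ := exists_detecting_function (fun k => x (σ k))
    (fun k => P.Q (r (σ k)) (s (σ k)) (x (σ k)))
  obtain ⟨h, hhD, hh⟩ := Metric.dense_iff.1 hD φ (1 / 16) (by norm_num)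
  rw [Metric.mem_ball, dist_eq_norm] at hhD
  obtain ⟨t, ht, hev⟩ := hP.exists_eventually_norm_sub_le hs₀ hh (ε := 1 / 16) (by norm_num)
  have ht0 : 0 ≤ t := hs₀.1.trans ht.1
  obtain ⟨C, hC⟩ := hP.exists_lipschitz ht0 ht.2 hh
  have hlim' : Tendsto (fun k => s (σ k)) atTop (𝓝[Set.Icc 0 a] s₀) :=
    tendsto_nhdsWithin_iff.2 ⟨hlim, Eventually.of_forall fun k =>
      ⟨(hr _).trans (hrs _), hsa _⟩⟩
  obtain ⟨k, hk, ⟨hst, hsm⟩, hCk⟩ := (hφ.and_eventually ((hlim'.eventually hev).and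
    (eventually_ge_atTop ⌈4 * C⌉₊))).exists
  have h1 := hk (P.T (s (σ k)) t h) (by
    calc ‖P.T (s (σ k)) t h - φ‖ = ‖(P.T (s (σ k)) t h - h) + (h - φ)‖ := by abel_nf
      _ ≤ _ := norm_add_le _ _
      _ ≤ 1 / 8 := by linarith)
  have h2 : ∫ y, P.T (s (σ k)) t h y ∂(P.Q (r (σ k)) (s (σ k)) (x (σ k))) =
      P.T (r (σ k)) t h (x (σ k)) := by
    rw [← P.T_apply, P.T_comp (hr _) (hrs _) hst ht.2]
  rw [h2] at h1
  have h3 := BR.abs_sub_le (P.T (r (σ k)) t h) (P.T (s (σ k)) t h) (x (σ k))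
  have h4 := hC (r (σ k)) ⟨hr _, (hrs _).trans hst⟩ (s (σ k)) ⟨(hr _).trans (hrs _), hst⟩
  have h5 := hrs (σ k)
  rw [abs_sub_comm, abs_of_nonneg (sub_nonneg.2 h5)] at h4
  have h6 := hlt (σ k)
  have h7 : 4 * C ≤ σ k :=
    (Nat.le_ceil _).trans (by exact_mod_cast hCk.trans (hσ.id_le k))
  have h8 := mul_le_mul_of_nonneg_right h7 (sub_nonneg.2 h5)
  rw [leave] at h6
  linarith

end TransitionSystem

end SetMarkov

namespace SetMarkov

namespace TransitionSystem

/-! ### The generators as bounded operators on the whole space -/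

variable {a : ℝ} {P : TransitionSystem a} {D : Submodule ℝ BR}

theorem HasGenerator.sub {s : ℝ} {h h' k k' : BR} (H : P.HasGenerator s h k)
    (H' : P.HasGenerator s h' k') : P.HasGenerator s (h - h') (k - k') := by
  have := H.add (H'.smul (-1))
  simpa [sub_eq_add_neg] using this

theorem HasGenerator.genApply_eq {s : ℝ} {h k : BR} (H : P.HasGenerator s h k) (x : ℝ) :
    genApply (P.generator s) (fun x => h x) x = k x := by
  have hdom : InDomain (P.generator s) (fun x => h x) := ⟨⟨h, k, H⟩, rfl⟩
  rw [genApply, dif_pos hdom]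
  have h1 : (hdom.choose : BR) = h := BR.ext_apply fun y => congrFun hdom.choose_spec y
  have h2 : P.HasGenerator s hdom.choose (P.generator s hdom.choose) :=
    (P.exists_hasGenerator hdom.choose).choose_spec
  rw [h1] at h2
  rw [h2.unique H]

theorem HasGenerator.inDomain {s : ℝ} {h k : BR} (H : P.HasGenerator s h k) :
    InDomain (P.generator s) (fun x => h x) := ⟨⟨h, k, H⟩, rfl⟩

theorem eventually_Ioo_left {s : ℝ} (hs : 0 < s) : ∀ᶠ r in 𝓝[<] s, r ∈ Set.Ioo 0 s :=
  Ioo_mem_nhdsLT hs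

/-- The constant `L` bounds the rates at which the system leaves its current state. -/
def LeaveBound (P : TransitionSystem a) (L : ℝ) : Prop :=
  0 ≤ L ∧ ∀ r s, 0 ≤ r → r ≤ s → s ≤ a → ∀ x, P.leave r s x ≤ L * (s - r)

theorem LeaveBound.norm_quotient_le {L : ℝ} (hL : P.LeaveBound L) {s : ℝ} (hsa : s ≤ a)
    (h : BR) {r : ℝ} (hr : r ∈ Set.Ioo 0 s) :
    ‖(s - r)⁻¹ • (P.T r s h - h)‖ ≤ 2 * L * ‖h‖ := by
  have hpos : 0 < s - r := sub_pos.2 hr.2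
  have h1 := P.norm_T_sub_le (mul_nonneg hL.1 hpos.le) (hL.2 r s hr.1.le hr.2.le hsa) h
  rw [norm_smul, Real.norm_of_nonneg (inv_nonneg.2 hpos.le), inv_mul_le_iff₀ hpos]
  linarith

theorem HasGenerator.norm_le {L : ℝ} (hL : P.LeaveBound L) {s : ℝ} (hs : 0 < s) (hsa : s ≤ a)
    {h k : BR} (H : P.HasGenerator s h k) : ‖k‖ ≤ 2 * L * ‖h‖ :=
  le_of_tendsto H.norm ((eventually_Ioo_left hs).mono fun _ hr => hL.norm_quotient_le hsa h hr)

/-- The backward equation for the elements of `D`. -/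
theorem IsRegularOn.hasGenerator_T (hP : P.IsRegularOn D) {v t : ℝ} (hv : v ∈ Set.Ioc 0 t)
    (hta : t ≤ a) {h : BR} (hh : h ∈ D) :
    P.HasGenerator v (P.T v t h) (-derivWithin (fun r => P.T r t h) (Set.Icc 0 t) v) := by
  have hvI : v ∈ Set.Icc 0 t := ⟨hv.1.le, hv.2⟩
  have h1 : HasDerivWithinAt (fun r => P.T r t h)
      (derivWithin (fun r => P.T r t h) (Set.Icc 0 t) v) (Set.Icc 0 t) v :=
    ((hP.contDiff_left t (hv.1.le.trans hv.2) hta h hh).differentiableOn one_ne_zero v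
      hvI).hasDerivWithinAt
  have hle : 𝓝[<] v ≤ 𝓝[Set.Icc 0 t \ {v}] v :=
    nhdsWithin_le_of_mem <| mem_of_superset (Ioo_mem_nhdsLT hv.1)
      fun r hr => ⟨⟨hr.1.le, hr.2.le.trans hv.2⟩, hr.2.ne⟩
  have h2 := ((hasDerivWithinAt_iff_tendsto_slope.1 h1).mono_left hle).neg
  refine h2.congr' ((eventually_Ioo_left hv.1).mono fun r hr => ?_)
  beta_reduce
  rw [slope_def_module, P.T_comp hr.1.le hr.2.le hv.2 hta, ← neg_smul, ← inv_neg, neg_sub]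

theorem IsRegularOn.exists_hasGenerator (hP : P.IsRegularOn D) (hD : Dense (D : Set BR))
    {L : ℝ} (hL : P.LeaveBound L) {s : ℝ} (hs : 0 < s) (hsa : s ≤ a) (h : BR) :
    ∃ k, P.HasGenerator s h k := by
  refine cauchy_map_iff_exists_tendsto.1 (Metric.cauchy_iff.2 ⟨inferInstance, fun ε hε => ?_⟩)
  have hδ : 0 < ε / (8 * L + 8) := by have := hL.1; positivity
  obtain ⟨d, hd, hdD⟩ := Metric.dense_iff.1 hD h _ hδ
  rw [Metric.mem_ball, dist_eq_norm, lt_div_iff₀ (by have := hL.1; positivity)] at hd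
  have hgen := hP.hasGenerator_T ⟨hs, le_rfl⟩ hsa hdD
  rw [P.T_self hs.le hsa] at hgen
  refine ⟨_, image_mem_map (inter_mem (eventually_Ioo_left hs)
    (hgen.eventually (Metric.ball_mem_nhds _ (show 0 < ε / 4 by positivity)))), ?_⟩
  have key : ∀ r ∈ Set.Ioo 0 s, dist ((s - r)⁻¹ • (P.T r s h - h)) ((s - r)⁻¹ • (P.T r s d - d))
      < ε / 4 := fun r hr => by
    have h1 := hL.norm_quotient_le hsa (d - h) hr
    rw [dist_comm, dist_eq_norm, ← smul_sub, sub_sub_sub_comm, ← map_sub]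
    have := norm_nonneg (d - h)
    linarith
  rintro _ ⟨r, ⟨hr, hr'⟩, rfl⟩ _ ⟨q, ⟨hq, hq'⟩, rfl⟩
  have h1 := key r hr
  have h2 := key q hq
  change dist _ _ < _ at hr' hq'
  have h3 := dist_triangle4 ((s - r)⁻¹ • (P.T r s h - h)) ((s - r)⁻¹ • (P.T r s d - d))
    ((s - q)⁻¹ • (P.T q s d - d)) ((s - q)⁻¹ • (P.T q s h - h))
  have h4 := dist_triangle_right ((s - r)⁻¹ • (P.T r s d - d)) ((s - q)⁻¹ • (P.T q s d - d))
    (-derivWithin (fun r => P.T r s d) (Set.Icc 0 s) s)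
  rw [dist_comm] at h2
  linarith

/-- The properties of the functions `v ↦ 𝒢_v T_{vt} φ` used below: they hold for all `φ ∈ B(ℝ)`,
by approximation from a dense subspace of regular functions. -/
structure BackwardEquation (P : TransitionSystem a) (K : ℝ) : Prop where
  nonneg : 0 ≤ K
  inDomain : ∀ {v t : ℝ}, v ∈ Set.Ioc 0 t → t ≤ a → ∀ φ : BR,
    InDomain (P.generator v) (P.apply v t (fun x => φ x))
  abs_le : ∀ {v t : ℝ}, v ∈ Set.Ioc 0 t → t ≤ a → ∀ (φ : BR) (x : ℝ),
    |genApply (P.generator v) (P.apply v t (fun x => φ x)) x| ≤ K * ‖φ‖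
  tendsto : ∀ {v t : ℝ}, v ∈ Set.Ioc 0 t → t ≤ a → ∀ (φ : BR) (x : ℝ),
    Tendsto (fun r => (v - r)⁻¹ * (P.apply r t (fun x => φ x) x - P.apply v t (fun x => φ x) x))
      (𝓝[<] v) (𝓝 (genApply (P.generator v) (P.apply v t (fun x => φ x)) x))
  continuousOn : ∀ {t : ℝ}, t ≤ a → ∀ (φ : BR) (x : ℝ),
    ContinuousOn (fun v => genApply (P.generator v) (P.apply v t (fun x => φ x)) x) (Set.Ioc 0 t)
  integral_eq : ∀ {s t : ℝ}, 0 < s → s ≤ t → t ≤ a → ∀ (φ : BR) (x : ℝ),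
    ∫ v in s..t, genApply (P.generator v) (P.apply v t (fun x => φ x)) x =
      P.apply s t (fun x => φ x) x - φ x

theorem IsRegularOn.exists_backwardEquation (hP : P.IsRegularOn D) (hD : Dense (D : Set BR)) :
    ∃ K, P.BackwardEquation K := by
  obtain ⟨L, hL⟩ : ∃ L, P.LeaveBound L := hP.exists_leave_le hD
  have hex : ∀ {v t : ℝ}, v ∈ Set.Ioc 0 t → t ≤ a → ∀ φ : BR, ∃ k, P.HasGenerator v (P.T v t φ) k :=
    fun hv ht φ => hP.exists_hasGenerator hD hL hv.1 (hv.2.trans ht) _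
  have hval : ∀ {v t : ℝ} {φ k : BR}, P.HasGenerator v (P.T v t φ) k → ∀ x,
      genApply (P.generator v) (P.apply v t (fun x => φ x)) x = k x := fun H x => H.genApply_eq x
  have hK : 0 ≤ 2 * L := by have := hL.1; positivity
  have hbd : ∀ {v t : ℝ}, v ∈ Set.Ioc 0 t → t ≤ a → ∀ {φ k : BR},
      P.HasGenerator v (P.T v t φ) k → ‖k‖ ≤ 2 * L * ‖φ‖ := fun hv ht φ k H =>
    (H.norm_le hL hv.1 (hv.2.trans ht)).trans
      (mul_le_mul_of_nonneg_left (P.norm_T_le _ _ _) hK)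
  have hdiff : ∀ {v t : ℝ}, v ∈ Set.Ioc 0 t → t ≤ a → ∀ (φ ψ : BR) (x : ℝ),
      |genApply (P.generator v) (P.apply v t (fun x => φ x)) x -
        genApply (P.generator v) (P.apply v t (fun x => ψ x)) x| ≤ 2 * L * ‖φ - ψ‖ := by
    intro v t hv ht φ ψ x
    obtain ⟨k, hk⟩ := hex hv ht φ
    obtain ⟨k', hk'⟩ := hex hv ht ψ
    rw [hval hk, hval hk']
    have := hk.sub hk'
    rw [← map_sub] at this
    exact (BR.abs_sub_le k k' x).trans (hbd hv ht this)
  have hcontD : ∀ {t : ℝ}, t ≤ a → ∀ φ ∈ D, ∀ x, ContinuousOn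
      (fun v => genApply (P.generator v) (P.apply v t (fun x => φ x)) x) (Set.Ioc 0 t) := by
    intro t hta φ hφ x
    rcases le_or_gt t 0 with ht | ht
    · rw [Set.Ioc_eq_empty (not_lt.2 ht)]
      exact continuousOn_empty _
    have h1 := (hP.contDiff_left t ht.le hta φ hφ).continuousOn_derivWithin
      (uniqueDiffOn_Icc ht) le_rfl
    have h2 := ((BR.eval x).continuous.comp_continuousOn h1.neg).mono
      (Set.Ioc_subset_Icc_self)
    exact h2.congr fun v hv => hval (hP.hasGenerator_T hv hta hφ) x
  have hcont : ∀ {t : ℝ}, t ≤ a → ∀ (φ : BR) (x : ℝ), ContinuousOn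
      (fun v => genApply (P.generator v) (P.apply v t (fun x => φ x)) x) (Set.Ioc 0 t) := by
    intro t hta φ x
    refine continuousOn_of_uniform_approx_of_continuousOn fun w hw => ?_
    obtain ⟨ε, hε, hεw⟩ := Metric.mem_uniformity_dist.1 hw
    have hδ : 0 < ε / (2 * L + 1) := by positivity
    obtain ⟨d, hd, hdD⟩ := Metric.dense_iff.1 hD φ _ hδ
    rw [Metric.mem_ball, dist_comm, dist_eq_norm, lt_div_iff₀ (by positivity)] at hd
    refine ⟨_, hcontD hta d hdD x, fun v hv => hεw ?_⟩
    rw [Real.dist_eq]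
    have := hdiff hv hta φ d x
    have := norm_nonneg (φ - d)
    linarith
  have hintble : ∀ {s t : ℝ}, 0 < s → s ≤ t → t ≤ a → ∀ (φ : BR) (x : ℝ), IntervalIntegrable
      (fun v => genApply (P.generator v) (P.apply v t (fun x => φ x)) x) volume s t :=
    fun hs hst hta φ x => ((hcont hta φ x).mono fun v hv => by
      rw [Set.uIcc_of_le hst] at hv
      exact ⟨hs.trans_le hv.1, hv.2⟩).intervalIntegrable
  have hintD : ∀ {s t : ℝ}, 0 < s → s ≤ t → t ≤ a → ∀ φ ∈ D, ∀ (x : ℝ),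
      ∫ v in s..t, genApply (P.generator v) (P.apply v t (fun x => φ x)) x =
        P.apply s t (fun x => φ x) x - φ x := by
    intro s t hs hst hta φ hφ x
    have ht : 0 < t := hs.trans_le hst
    have hC := hP.contDiff_left t ht.le hta φ hφ
    have h1 := intervalIntegral.integral_eq_sub_of_hasDerivAt_of_le hst
      (f := fun v => -(P.T v t φ x))
      (f' := fun v => genApply (P.generator v) (P.apply v t (fun x => φ x)) x)
      (((BR.eval x).continuous.comp_continuousOn hC.continuousOn).neg.mono
        (Set.Icc_subset_Icc_left hs.le)) (fun v hv => by
          have hv0 : 0 < v := hs.trans hv.1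
          have hnhds : Set.Icc 0 t ∈ 𝓝 v := Icc_mem_nhds hv0 hv.2
          rw [hval (hP.hasGenerator_T ⟨hv0, hv.2.le⟩ hta hφ)]
          have h2 : HasDerivAt (fun r => P.T r t φ)
              (derivWithin (fun r => P.T r t φ) (Set.Icc 0 t) v) v :=
            ((hC.differentiableOn one_ne_zero v ⟨hv0.le, hv.2.le⟩).hasDerivWithinAt).hasDerivAt
              hnhds
          exact ((BR.eval x).hasFDerivAt.comp_hasDerivAt v h2).neg)
      (hintble hs hst hta φ x)
    rw [h1, P.T_self ht.le hta]
    change -(φ x) - -(P.T s t φ x) = P.T s t φ x - φ x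
    ring
  refine ⟨2 * L, hK, ?_, ?_, ?_, hcont, ?_⟩
  · intro v t hv ht φ
    obtain ⟨k, hk⟩ := hex hv ht φ
    exact hk.inDomain
  · intro v t hv ht φ x
    obtain ⟨k, hk⟩ := hex hv ht φ
    rw [hval hk]
    exact (BR.abs_le_norm k x).trans (hbd hv ht hk)
  · intro v t hv ht φ x
    obtain ⟨k, hk⟩ := hex hv ht φ
    rw [hval hk]
    refine (BR.tendsto_apply hk x).congr' ((eventually_Ioo_left hv.1).mono fun r hr => ?_)
    rw [P.T_comp hr.1.le hr.2.le hv.2 ht]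
    rfl
  · intro s t hs hst hta φ x
    rw [← sub_eq_zero, ← abs_nonpos_iff]
    refine le_of_forall_pos_le_add fun ε hε => ?_
    have hM : 0 < 2 * L * (t - s) + 2 := by
      have := mul_nonneg hK (sub_nonneg.2 hst)
      linarith
    obtain ⟨d, hd, hdD⟩ := Metric.dense_iff.1 hD φ _ (div_pos hε hM)
    rw [Metric.mem_ball, dist_comm, dist_eq_norm, lt_div_iff₀ hM] at hd
    have h1 := hintD hs hst hta d hdD x
    have h2 : |(∫ v in s..t, genApply (P.generator v) (P.apply v t (fun x => φ x)) x) -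
        ∫ v in s..t, genApply (P.generator v) (P.apply v t (fun x => d x)) x| ≤
        2 * L * ‖φ - d‖ * (t - s) := by
      rw [← intervalIntegral.integral_sub (hintble hs hst hta φ x) (hintble hs hst hta d x)]
      have := intervalIntegral.norm_integral_le_of_norm_le_const (a := s) (b := t)
        (C := 2 * L * ‖φ - d‖)
        (f := fun v => genApply (P.generator v) (P.apply v t (fun x => φ x)) x -
          genApply (P.generator v) (P.apply v t (fun x => d x)) x) (fun v hv => by
            rw [Set.uIoc_of_le hst] at hv
            exact hdiff ⟨hs.trans hv.1, hv.2⟩ hta φ d x)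
      rwa [abs_of_nonneg (sub_nonneg.2 hst)] at this
    have h3 : |P.apply s t (fun x => φ x) x - P.apply s t (fun x => d x) x| ≤ ‖φ - d‖ := by
      have := P.norm_T_le s t (φ - d)
      rw [map_sub] at this
      exact (BR.abs_sub_le (P.T s t φ) (P.T s t d) x).trans this
    have h4 := BR.abs_sub_le φ d x
    rw [abs_le] at h2 h3 h4 ⊢
    constructor <;> linarith

end TransitionSystem

end SetMarkov

namespace SetMarkov

/-! ### Iterated integrals as integrals over a path space -/

/-- Bounded measurable real functions. -/
def IsBddMeas {E : Type*} [MeasurableSpace E] (F : E → ℝ) : Prop :=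
  Measurable F ∧ ∃ C, ∀ y, |F y| ≤ C

namespace IsBddMeas

variable {E : Type*} [MeasurableSpace E] {F G : E → ℝ}

theorem const (c : ℝ) : IsBddMeas fun _ : E => c := ⟨measurable_const, |c|, fun _ => le_rfl⟩

theorem add (hF : IsBddMeas F) (hG : IsBddMeas G) : IsBddMeas fun y => F y + G y := by
  obtain ⟨hF, C, hC⟩ := hF
  obtain ⟨hG, C', hC'⟩ := hG
  exact ⟨hF.add hG, C + C', fun y => (abs_add_le _ _).trans (add_le_add (hC y) (hC' y))⟩

theorem mul (hF : IsBddMeas F) (hG : IsBddMeas G) : IsBddMeas fun y => F y * G y := by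
  obtain ⟨hF, C, hC⟩ := hF
  obtain ⟨hG, C', hC'⟩ := hG
  refine ⟨hF.mul hG, C * C', fun y => ?_⟩
  rw [abs_mul]
  exact mul_le_mul (hC y) (hC' y) (abs_nonneg _) ((abs_nonneg _).trans (hC y))

theorem sub (hF : IsBddMeas F) (hG : IsBddMeas G) : IsBddMeas fun y => F y - G y := by
  simpa [sub_eq_add_neg] using hF.add ((const (-1)).mul hG)

theorem comp {E' : Type*} [MeasurableSpace E'] (hF : IsBddMeas F) {g : E' → E}
    (hg : Measurable g) : IsBddMeas fun y => F (g y) :=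
  ⟨hF.1.comp hg, hF.2.imp fun _ hC y => hC (g y)⟩

theorem finset_prod {ι : Type*} (s : Finset ι) {f : ι → E → ℝ} (hf : ∀ i, IsBddMeas (f i)) :
    IsBddMeas fun y => ∏ i ∈ s, f i y := by
  classical
  induction s using Finset.induction_on with
  | empty => simpa using const 1
  | insert i s hi ih => simpa [Finset.prod_insert hi] using (hf i).mul ih

theorem indicator_one {Γ : Set E} (hΓ : MeasurableSet Γ) :
    IsBddMeas (Γ.indicator (1 : E → ℝ)) :=
  ⟨measurable_one.indicator hΓ, 1, fun x => by by_cases h : x ∈ Γ <;> simp [h]⟩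

theorem integrable (hF : IsBddMeas F) (μ : Measure E) [IsFiniteMeasure μ] : Integrable F μ := by
  obtain ⟨hF, C, hC⟩ := hF
  exact Integrable.of_bound hF.aestronglyMeasurable C (Eventually.of_forall hC)

theorem integral_kernel {E' : Type*} [MeasurableSpace E'] (hF : IsBddMeas F) (κ : Kernel E' E)
    [IsMarkovKernel κ] : IsBddMeas fun y => ∫ z, F z ∂(κ y) := by
  obtain ⟨hF, C, hC⟩ := hF
  refine ⟨hF.stronglyMeasurable.integral_kernel.measurable, C, fun y => ?_⟩
  simpa using norm_integral_le_of_norm_le_const (μ := κ y) (f := F) (Eventually.of_forall hC)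

end IsBddMeas

theorem BR.isBddMeas (h : BR) : IsBddMeas fun x => h x :=
  ⟨BR.measurable h, ‖h‖, BR.abs_le_norm h⟩

/-- A bounded measurable function, as an element of `B(ℝ)`. -/
def IsBddMeas.toBR {φ : ℝ → ℝ} (h : IsBddMeas φ) : BR := BR.mk φ h.1 h.2

namespace TransitionSystem

variable {a : ℝ} (P : TransitionSystem a) (u : ℕ → ℝ)

/-- The kernel on paths which replaces the coordinate `y l` by a random value with distribution
`Q_{u_k u_l}(y k; ·)`. -/
def stepKernel (k l : ℕ) : Kernel (ℕ → ℝ) (ℕ → ℝ) :=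
  ((Kernel.id : Kernel (ℕ → ℝ) (ℕ → ℝ)) ×ₖ
    (P.Q (u k) (u l)).comap (fun y => y k) (measurable_pi_apply k)).map
      (fun p => Function.update p.1 l p.2)

instance (k l : ℕ) : IsMarkovKernel (P.stepKernel u k l) :=
  Kernel.IsMarkovKernel.map _ measurable_update'

theorem stepKernel_apply (k l : ℕ) (y : ℕ → ℝ) :
    P.stepKernel u k l y = (P.Q (u k) (u l) (y k)).map (fun z => Function.update y l z) := by
  rw [stepKernel, Kernel.map_apply _ measurable_update', Kernel.prod_apply, Kernel.id_apply,
    Kernel.comap_apply, Measure.dirac_prod, Measure.map_map measurable_update' (by fun_prop)]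
  rfl

/-- The distribution of a path resampled successively at the indices in a list. -/
def pathKernel : ℕ → List ℕ → Kernel (ℕ → ℝ) (ℕ → ℝ)
  | _, [] => Kernel.id
  | k, l :: ls => pathKernel l ls ∘ₖ P.stepKernel u k l

instance isMarkovKernel_pathKernel (k : ℕ) (ls : List ℕ) :
    IsMarkovKernel (P.pathKernel u k ls) := by
  induction ls generalizing k with
  | nil => exact inferInstanceAs (IsMarkovKernel Kernel.id)
  | cons l ls ih =>
    have := ih l
    exact inferInstanceAs (IsMarkovKernel (P.pathKernel u l ls ∘ₖ P.stepKernel u k l))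

theorem iter_eq_integral {F : (ℕ → ℝ) → ℝ} (hF : IsBddMeas F) (k : ℕ) (ls : List ℕ)
    (y : ℕ → ℝ) : P.iter u k ls F y = ∫ y', F y' ∂(P.pathKernel u k ls y) := by
  induction ls generalizing k y with
  | nil =>
    rw [iter, pathKernel, Kernel.id_apply, integral_dirac' _ _ hF.1.stronglyMeasurable]
  | cons l ls ih =>
    rw [iter, pathKernel, Kernel.integral_comp (hF.integrable _), stepKernel_apply,
      integral_map (measurable_update y).aemeasurable
        (hF.integral_kernel (P.pathKernel u l ls)).1.aestronglyMeasurable]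
    exact integral_congr_ae (Eventually.of_forall fun z => ih l _)

variable {P u} in
theorem _root_.SetMarkov.IsBddMeas.iter {F : (ℕ → ℝ) → ℝ} (hF : IsBddMeas F) (k : ℕ)
    (ls : List ℕ) : IsBddMeas (P.iter u k ls F) := by
  have : P.iter u k ls F = fun y => ∫ y', F y' ∂(P.pathKernel u k ls y) :=
    funext fun y => P.iter_eq_integral u hF k ls y
  rw [this]
  exact hF.integral_kernel _

theorem iter_append (k m : ℕ) (ls ls' : List ℕ) (F : (ℕ → ℝ) → ℝ) (y : ℕ → ℝ) :
    P.iter u k (ls ++ m :: ls') F y = P.iter u k (ls ++ [m]) (P.iter u m ls' F) y := by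
  induction ls generalizing k y with
  | nil => simp [iter]
  | cons l ls ih => simp [iter, ih]

theorem iter_congr {F G : (ℕ → ℝ) → ℝ} (k : ℕ) {ls : List ℕ} {y : ℕ → ℝ}
    (h : ∀ y', (∀ s, s ∉ ls → y' s = y s) → F y' = G y') :
    P.iter u k ls F y = P.iter u k ls G y := by
  induction ls generalizing k y with
  | nil => exact h y fun _ _ => rfl
  | cons l ls ih =>
    simp only [iter]
    refine integral_congr_ae (Eventually.of_forall fun z => ih l fun y' hy' => h y' fun s hs => ?_)
    rw [List.mem_cons, not_or] at hs
    rw [hy' s hs.2, Function.update_of_ne hs.1]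

theorem iter_const_mul (c : ℝ) (F : (ℕ → ℝ) → ℝ) (k : ℕ) (ls : List ℕ) (y : ℕ → ℝ) :
    P.iter u k ls (fun y => c * F y) y = c * P.iter u k ls F y := by
  induction ls generalizing k y with
  | nil => rfl
  | cons l ls ih => simp only [iter, ih, integral_const_mul]

theorem iter_sub {F G : (ℕ → ℝ) → ℝ} (hF : IsBddMeas F) (hG : IsBddMeas G) (k : ℕ)
    (ls : List ℕ) (y : ℕ → ℝ) : P.iter u k ls (fun y => F y - G y) y =
      P.iter u k ls F y - P.iter u k ls G y := by
  rw [P.iter_eq_integral u (hF.sub hG), P.iter_eq_integral u hF, P.iter_eq_integral u hG,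
    integral_sub (hF.integrable _) (hG.integrable _)]

theorem iter_agree {F : (ℕ → ℝ) → ℝ} {S : Set ℕ} (hF : DependsOn F S) {k : ℕ} {ls : List ℕ}
    {y y' : ℕ → ℝ} (hk : y k = y' k) (h : ∀ s ∈ S, s ∉ ls → y s = y' s) :
    P.iter u k ls F y = P.iter u k ls F y' := by
  induction ls generalizing k y y' with
  | nil => exact hF fun s hs => h s hs List.not_mem_nil
  | cons l ls ih =>
    simp only [iter, hk]
    refine integral_congr_ae (Eventually.of_forall fun z => ih (by simp) fun s hs hsl => ?_)
    by_cases hsl' : s = l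
    · simp [hsl']
    · rw [Function.update_of_ne hsl', Function.update_of_ne hsl']
      exact h s hs (by simp [hsl, hsl'])

/-- The values `u 0 ≤ … ≤ u n` form a (weak) partition inside the time interval `[0, a]`. -/
structure IsPartition (a : ℝ) (n : ℕ) (u : ℕ → ℝ) : Prop where
  mono : ∀ {i j : ℕ}, i ≤ j → j ≤ n → u i ≤ u j
  nonneg : 0 ≤ u 0
  le : u n ≤ a

variable {u} in
theorem iter_cons_self {n : ℕ} (hu : IsPartition a n u) {F : (ℕ → ℝ) → ℝ} (hF : IsBddMeas F)
    {k : ℕ} (hk : k ≤ n) (ls : List ℕ) (y : ℕ → ℝ) :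
    P.iter u k (k :: ls) F y = P.iter u k ls F y := by
  rw [iter, P.self (u k) (hu.nonneg.trans (hu.mono k.zero_le hk)) ((hu.mono hk le_rfl).trans hu.le),
    integral_dirac' _ _ ((hF.iter (P := P) (u := u) k ls).comp
      (measurable_update y)).1.stronglyMeasurable, Function.update_eq_self]

variable {u} in
/-- By the Chapman–Kolmogorov equations, times whose variables do not occur in the integrand may be
inserted into an iterated integral, and repeated times may be dropped. -/
theorem iter_eq_iter_range' {n : ℕ} (hu : IsPartition a n u) {F : (ℕ → ℝ) → ℝ}
    (hF : IsBddMeas F) {S : Set ℕ} (hFS : DependsOn F S) {k : ℕ} (hk : k ≤ n) {ls : List ℕ}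
    (hls : (k :: ls).Pairwise (· ≤ ·)) (hn : ∀ l ∈ ls, l ≤ n)
    (hS : ∀ s ∈ S, k < s → s ≤ n → s ∈ ls) (y : ℕ → ℝ) :
    P.iter u k ls F y = P.iter u k (List.range' (k + 1) (n - k)) F y := by
  obtain ⟨d, hd⟩ : ∃ d, n - k = d := ⟨_, rfl⟩
  rw [hd]
  induction d generalizing k ls y with
  | zero =>
    induction ls with
    | nil => rfl
    | cons l ls ih =>
      have hl := hn l List.mem_cons_self
      have hkl := List.rel_of_pairwise_cons hls List.mem_cons_self
      obtain rfl : l = k := by omega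
      rw [P.iter_cons_self hu hF hk]
      exact ih hls.tail (fun m hm => hn m (List.mem_cons_of_mem _ hm))
        (fun s hs h1 h2 => by omega)
  | succ d ihd =>
    have step : ∀ ls : List ℕ, ((k + 1) :: ls).Pairwise (· ≤ ·) → (∀ l ∈ ls, l ≤ n) →
        (∀ s ∈ S, k + 1 < s → s ≤ n → s ∈ ls) →
        P.iter u k (List.range' (k + 1) (d + 1)) F y =
          P.iter u k ((k + 1) :: ls) F y := fun ls h1 h2 h3 => by
      rw [List.range'_succ, iter, iter]
      exact integral_congr_ae (Eventually.of_forall fun z =>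
        (ihd (by omega) h1 h2 h3 _ (by omega)).symm)
    induction ls with
    | nil =>
      rw [step [] (List.pairwise_singleton _ _) (by simp) (fun s hs h1 h2 => hS s hs (by omega) h2)]
      have : ∀ z, F (Function.update y (k + 1) z) = F y := fun z => hFS fun s hs => by
        refine Function.update_of_ne ?_ _ _
        rintro rfl
        exact absurd (hS _ hs (by omega) (by omega)) List.not_mem_nil
      simp [iter, this]
    | cons l ls ih =>
      have hl := hn l List.mem_cons_self
      have hkl := List.rel_of_pairwise_cons hls List.mem_cons_self
      have hn' : ∀ m ∈ ls, m ≤ n := fun m hm => hn m (List.mem_cons_of_mem _ hm)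
      have hlls : (l :: ls).Pairwise (· ≤ ·) := hls.tail
      have hlm := fun m hm => List.rel_of_pairwise_cons hlls (a' := m) hm
      rcases hkl.eq_or_lt with rfl | hlt
      · rw [P.iter_cons_self hu hF hk]
        refine ih hlls hn' (fun s hs h1 h2 => ?_)
        exact (List.mem_cons.1 (hS s hs h1 h2)).resolve_left (by omega)
      rcases (Nat.succ_le_of_lt hlt).eq_or_lt with rfl | hlt'
      · refine (step ls hlls hn' fun s hs h1 h2 => ?_).symm
        exact (List.mem_cons.1 (hS s hs (by omega) h2)).resolve_left (by simp; omega)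
      · rw [step (l :: ls) (List.pairwise_cons.2 ⟨fun m hm => ?_, hlls⟩) hn
          (fun s hs h1 h2 => hS s hs (by omega) h2)]
        · have hG : IsBddMeas fun z => P.iter u l ls F (Function.update y l z) :=
            (hF.iter l ls).comp (measurable_update y)
          obtain ⟨C, hC⟩ := hG.2
          simp only [iter, Function.update_self]
          rw [P.integral_chapman (hu.nonneg.trans (hu.mono k.zero_le hk))
            (hu.mono (Nat.le_succ k) (by omega)) (hu.mono hlt'.le hl)
            ((hu.mono hl le_rfl).trans hu.le) (y k) hG.1 hC]
          refine integral_congr_ae (Eventually.of_forall fun z =>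
            integral_congr_ae (Eventually.of_forall fun z' =>
              P.iter_agree u hFS (by simp) fun s hs hsl => ?_))
          by_cases hsl' : s = l
          · simp [hsl']
          · rw [Function.update_of_ne hsl', Function.update_of_ne hsl', Function.update_of_ne]
            rintro rfl
            exact (List.mem_cons.1 (hS _ hs (by omega) (by omega))).elim hsl' hsl
        · rcases List.mem_cons.1 hm with rfl | hm
          · exact hlt'.le
          · exact hlt'.le.trans (hlm m hm)

end TransitionSystem

end SetMarkov

namespace SetMarkov

/-! ### The ordered list of levels -/

section Levels

variable (π : ℕ → ℕ)

/-- The indices of the variables on which the increments numbered `2, …, m` depend. -/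
def incSupport (m : ℕ) : Set ℕ := {s | ∃ j, 2 ≤ j ∧ j ≤ m ∧ (s = π j - 1 ∨ s = π j)}

theorem incSupport_mono {m m' : ℕ} (h : m ≤ m') : incSupport π m ⊆ incSupport π m' :=
  fun _ ⟨j, h1, h2, h3⟩ => ⟨j, h1, h2.trans h, h3⟩

theorem levels_perm (i : ℕ) :
    (levels π i).Perm ((List.range' 2 (i - 1)).flatMap fun j => [π j - 1, π j]) :=
  List.perm_insertionSort _ _

theorem mem_flatMap_iff {m s : ℕ} :
    s ∈ ((List.range' 2 (m - 1)).flatMap fun j => [π j - 1, π j]) ↔ s ∈ incSupport π m := by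
  simp only [List.mem_flatMap, List.mem_range'_1, List.mem_cons, List.not_mem_nil, or_false,
    incSupport, Set.mem_ofPred_eq]
  constructor
  · rintro ⟨j, ⟨h1, h2⟩, h3⟩
    exact ⟨j, h1, by omega, h3⟩
  · rintro ⟨j, h1, h2, h3⟩
    exact ⟨j, ⟨h1, by omega⟩, h3⟩

theorem mem_levels_iff {i s : ℕ} : s ∈ levels π i ↔ s ∈ incSupport π i := by
  rw [(levels_perm π i).mem_iff, mem_flatMap_iff]

theorem levels_pairwise (i : ℕ) : (levels π i).Pairwise (· ≤ ·) :=
  List.pairwise_insertionSort _ _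

theorem length_levels (i : ℕ) : (levels π i).length = 2 * (i - 1) := by
  rw [(levels_perm π i).length_eq, List.length_flatMap]
  simp [mul_comm]

variable {π} {i : ℕ}

theorem idxOf_lt_length_levels (hi : 2 ≤ i) : (levels π i).idxOf (π i) < (levels π i).length :=
  List.idxOf_lt_length_iff.2 ((mem_levels_iff π).2 ⟨i, hi, le_rfl, Or.inr rfl⟩)

theorem levels_eq (hi : 2 ≤ i) (hπi : 1 ≤ π i) :
    levels π i = before π i ++ (π i - 1) :: π i :: after π i := by
  have hq := idxOf_lt_length_levels (π := π) hi
  have hsort := levels_pairwise π i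
  have hget : (levels π i)[(levels π i).idxOf (π i)] = π i := List.getElem_idxOf hq
  obtain ⟨r, hr, hrv⟩ := List.mem_iff_getElem.1
    ((mem_levels_iff π).2 ⟨i, hi, le_rfl, Or.inl rfl⟩ : π i - 1 ∈ levels π i)
  have hmono : ∀ {j k : ℕ} (hj : j < (levels π i).length) (hk : k < (levels π i).length),
      j ≤ k → (levels π i)[j] ≤ (levels π i)[k] := fun hj hk hjk => by
    rcases hjk.eq_or_lt with rfl | hlt
    · exact le_rfl
    · exact List.pairwise_iff_getElem.1 hsort _ _ hj hk hlt
  rw [before, after, pIndex]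
  generalize hqd : (levels π i).idxOf (π i) = q at *
  have hrq : r < q := by
    by_contra hle
    have := hmono hq hr (not_lt.1 hle)
    omega
  obtain ⟨p, rfl⟩ : ∃ p, q = p + 1 := ⟨q - 1, by omega⟩
  have hp : p < (levels π i).length := by omega
  have hpv : (levels π i)[p] = π i - 1 := by
    have h1 := hmono hr hp (by omega)
    have h2 := hmono hp hq (by omega)
    have h3 : (levels π i)[p] ≠ π i := fun h => by
      have hlt : p < List.findIdx (· == π i) (levels π i) := by
        have : List.findIdx (· == π i) (levels π i) = p + 1 := hqd
        omega
      simpa [h] using List.not_of_lt_findIdx hlt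
    omega
  have h1 : levels π i = (levels π i).take p ++ (levels π i).drop p :=
    (List.take_append_drop p _).symm
  rw [List.drop_eq_getElem_cons hp, List.drop_eq_getElem_cons hq, hpv, hget] at h1
  simpa using h1

theorem pIndex_eq_iff (hi : 2 ≤ i) : pIndex π i = 2 * (i - 1) ↔ after π i = [] := by
  have hq := idxOf_lt_length_levels (π := π) hi
  rw [after, List.drop_eq_nil_iff, ← length_levels π, pIndex]
  omega

theorem before_append_after_perm (hi : 2 ≤ i) (hπi : 1 ≤ π i) :
    (before π i ++ after π i).Perm
      ((List.range' 2 (i - 1 - 1)).flatMap fun j => [π j - 1, π j]) := by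
  have h1 := levels_perm π i
  obtain ⟨m, rfl⟩ : ∃ m, i = m + 2 := ⟨i - 2, by omega⟩
  have h2 : List.range' 2 (m + 2 - 1) = List.range' 2 (m + 2 - 1 - 1) ++ [m + 2] := by
    have : m + 2 - 1 = m + 1 := rfl
    rw [this, List.range'_concat]
    simp [add_comm]
  rw [levels_eq hi hπi, h2, List.flatMap_append] at h1
  simp only [List.flatMap_cons, List.flatMap_nil, List.append_nil] at h1
  have h3 : (before π (m + 2) ++ (π (m + 2) - 1) :: π (m + 2) :: after π (m + 2)).Perm
      ((before π (m + 2) ++ after π (m + 2)) ++ [π (m + 2) - 1, π (m + 2)]) := by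
    rw [List.append_assoc]
    exact List.Perm.append_left _
      (List.perm_append_comm (l₁ := [π (m + 2) - 1, π (m + 2)]) (l₂ := after π (m + 2)))
  exact (List.perm_append_right_iff _).1 (h3.symm.trans h1)

theorem mem_before_append_after (hi : 2 ≤ i) (hπi : 1 ≤ π i) {s : ℕ} :
    s ∈ before π i ++ after π i ↔ s ∈ incSupport π (i - 1) := by
  rw [(before_append_after_perm hi hπi).mem_iff, mem_flatMap_iff]

theorem le_of_mem_before (hi : 2 ≤ i) (hπi : 1 ≤ π i) {s : ℕ} (hs : s ∈ before π i) :
    s ≤ π i - 1 := by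
  have := levels_pairwise π i
  rw [levels_eq hi hπi] at this
  exact (List.pairwise_append.1 this).2.2 s hs _ List.mem_cons_self

theorem before_append_pairwise (hi : 2 ≤ i) (hπi : 1 ≤ π i) :
    (before π i ++ [π i - 1]).Pairwise (· ≤ ·) := by
  have := levels_pairwise π i
  rw [levels_eq hi hπi] at this
  exact this.sublist (List.Sublist.append_left (by simp) _)

theorem before_append_after_pairwise (hi : 2 ≤ i) (hπi : 1 ≤ π i) :
    (before π i ++ after π i).Pairwise (· ≤ ·) := by
  have := levels_pairwise π i
  rw [levels_eq hi hπi] at this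
  exact this.sublist (List.Sublist.append_left (by simp) _)

theorem cons_after_pairwise (hi : 2 ≤ i) (hπi : 1 ≤ π i) :
    (π i :: after π i).Pairwise (· ≤ ·) := by
  have := levels_pairwise π i
  rw [levels_eq hi hπi] at this
  exact (List.pairwise_append.1 this).2.1.tail

variable {n : ℕ}

theorem one_le_of_mem_incSupport (hπ : ∀ j, 2 ≤ j → j ≤ n → 2 ≤ π j ∧ π j ≤ n) {m s : ℕ}
    (hm : m ≤ n) (hs : s ∈ incSupport π m) : 1 ≤ s ∧ s ≤ n := by
  obtain ⟨j, h1, h2, h3⟩ := hs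
  have := hπ j h1 (h2.trans hm)
  omega

end Levels

section Increments

variable (π : ℕ → ℕ)

theorem dependsOn_incSum (m : ℕ) : DependsOn (incSum π m) (incSupport π m) := fun y y' h => by
  refine Finset.sum_congr rfl fun j hj => ?_
  rw [Finset.mem_Icc] at hj
  rw [h (π j) ⟨j, hj.1, hj.2, Or.inr rfl⟩, h (π j - 1) ⟨j, hj.1, hj.2, Or.inl rfl⟩]

theorem dependsOn_incProd (h : ℕ → BR) (m : ℕ) :
    DependsOn (incProd π h m) (incSupport π m) := fun y y' hy => by
  refine Finset.prod_congr rfl fun j hj => ?_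
  rw [Finset.mem_Icc] at hj
  rw [hy (π j) ⟨j, hj.1, hj.2, Or.inr rfl⟩, hy (π j - 1) ⟨j, hj.1, hj.2, Or.inl rfl⟩]

theorem measurable_incSum (m : ℕ) : Measurable (incSum π m) := by
  unfold incSum
  fun_prop

theorem isBddMeas_incProd (h : ℕ → BR) (m : ℕ) : IsBddMeas (incProd π h m) :=
  IsBddMeas.finset_prod _ fun j => (BR.isBddMeas (h j)).comp (by fun_prop)

theorem incSum_eq_add {i : ℕ} (hi : 2 ≤ i) (y : ℕ → ℝ) :
    incSum π i y = incSum π (i - 1) y + (y (π i) - y (π i - 1)) := by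
  obtain ⟨m, rfl⟩ : ∃ m, i = m + 1 := ⟨i - 1, by omega⟩
  rw [incSum, incSum, Finset.sum_Icc_succ_top hi, Nat.add_sub_cancel]

end Increments

end SetMarkov

namespace SetMarkov

namespace TransitionSystem

/-! ### Integrating the backward equation over a parameter -/

variable {a : ℝ} {P : TransitionSystem a} {K : ℝ} {Ω : Type*} [MeasurableSpace Ω]

theorem isBddMeas_apply (s t : ℝ) {Φ : Ω × ℝ → ℝ} (hΦ : IsBddMeas Φ) {e : Ω → ℝ}
    (he : Measurable e) : IsBddMeas fun ω => P.apply s t (fun z => Φ (ω, z)) (e ω) := by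
  obtain ⟨hΦm, C, hC⟩ := hΦ
  refine ⟨?_, C, fun ω => ?_⟩
  · exact (hΦm.stronglyMeasurable.integral_kernel_prod_right'
      (κ := (P.Q s t).comap e he)).measurable
  · simpa [apply] using norm_integral_le_of_norm_le_const (μ := P.Q s t (e ω))
      (f := fun z => Φ (ω, z)) (Eventually.of_forall fun z => hC (ω, z))

theorem _root_.SetMarkov.IsBddMeas.section_right {Φ : Ω × ℝ → ℝ} (hΦ : IsBddMeas Φ) (ω : Ω) :
    IsBddMeas fun z => Φ (ω, z) := hΦ.comp (by fun_prop)

theorem BackwardEquation.abs_genApply_le (hB : P.BackwardEquation K) {v t : ℝ}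
    (hv : v ∈ Set.Ioc 0 t) (ht : t ≤ a) {φ : ℝ → ℝ} (hφ : Measurable φ) {C : ℝ}
    (hC : ∀ z, |φ z| ≤ C) (x : ℝ) :
    |genApply (P.generator v) (P.apply v t φ) x| ≤ K * C :=
  (hB.abs_le hv ht (IsBddMeas.toBR ⟨hφ, C, hC⟩) x).trans <|
    mul_le_mul_of_nonneg_left (BR.norm_le ((abs_nonneg _).trans (hC 0)) hC) hB.nonneg

theorem BackwardEquation.isBddMeas_genApply (hB : P.BackwardEquation K) {v t : ℝ}
    (hv : v ∈ Set.Ioc 0 t) (ht : t ≤ a) {Φ : Ω × ℝ → ℝ} (hΦ : IsBddMeas Φ) {e : Ω → ℝ}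
    (he : Measurable e) :
    IsBddMeas fun ω =>
      genApply (P.generator v) (P.apply v t (fun z => Φ (ω, z))) (e ω) := by
  obtain ⟨C, hC⟩ := hΦ.2
  refine ⟨?_, K * C, fun ω =>
    hB.abs_genApply_le hv ht (hΦ.section_right ω).1 (fun z => hC (ω, z)) _⟩
  refine measurable_of_tendsto_metrizable' (𝓝[<] v)
    (f := fun r ω => (v - r)⁻¹ * (P.apply r t (fun z => Φ (ω, z)) (e ω) -
      P.apply v t (fun z => Φ (ω, z)) (e ω))) (fun r => ?_) (tendsto_pi_nhds.2 fun ω =>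
        hB.tendsto hv ht (hΦ.section_right ω).toBR (e ω))
  exact ((isBddMeas_apply r t hΦ he).1.sub (isBddMeas_apply v t hΦ he).1).const_mul _

/-- The backward equation, integrated over time and over a parameter `ω` on which the function, the
point of evaluation and a weight `c` depend. -/
theorem BackwardEquation.integral_integral (hB : P.BackwardEquation K) {s t : ℝ} (hs : 0 < s)
    (hst : s ≤ t) (ht : t ≤ a) {Φ : Ω × ℝ → ℝ} (hΦ : IsBddMeas Φ) {e : Ω → ℝ}
    (he : Measurable e) {c : Ω → ℝ} (hc : IsBddMeas c) (M : Measure Ω) [IsProbabilityMeasure M] :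
    IntervalIntegrable (fun v => ∫ ω, c ω *
      genApply (P.generator v) (P.apply v t (fun z => Φ (ω, z))) (e ω) ∂M) volume s t ∧
    ∫ v in s..t, (∫ ω, c ω *
      genApply (P.generator v) (P.apply v t (fun z => Φ (ω, z))) (e ω) ∂M) =
      ∫ ω, c ω * (P.apply s t (fun z => Φ (ω, z)) (e ω) - Φ (ω, e ω)) ∂M := by
  -- the time is clamped to `[s, t]` to obtain a function that is continuous on the whole line
  set κ : ℝ → ℝ := fun v => max s (min v t) with hκ
  have hκc : Continuous κ := by fun_prop
  have hκm : ∀ v, κ v ∈ Set.Ioc 0 t := fun v =>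
    ⟨hs.trans_le (le_max_left _ _), max_le hst (min_le_right _ _)⟩
  have hκe : ∀ v ∈ Set.Ioc s t, κ v = v := fun v hv => by
    rw [hκ]
    simp [hv.1.le, hv.2]
  let ψ : ℝ → Ω → ℝ := fun v ω =>
    c ω * genApply (P.generator (κ v)) (P.apply (κ v) t (fun z => Φ (ω, z))) (e ω)
  have hψm : StronglyMeasurable (Function.uncurry ψ) := by
    refine stronglyMeasurable_uncurry_of_continuous_of_stronglyMeasurable (fun ω => ?_) fun v => ?_
    · exact continuous_const.mul
        ((hB.continuousOn ht (hΦ.section_right ω).toBR (e ω)).comp_continuous hκc hκm)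
    · exact (hc.mul (hB.isBddMeas_genApply (hκm v) ht hΦ he)).1.stronglyMeasurable
  obtain ⟨C, hC⟩ := hΦ.2
  obtain ⟨C', hC'⟩ := hc.2
  have hψb : ∀ q, ‖Function.uncurry ψ q‖ ≤ C' * (K * C) := fun ⟨v, ω⟩ => by
    simp only [Function.uncurry, ψ, norm_mul]
    exact mul_le_mul (hC' ω) (hB.abs_genApply_le (hκm v) ht (hΦ.section_right ω).1
      (fun z => hC (ω, z)) _) (abs_nonneg _) ((abs_nonneg _).trans (hC' ω))
  have hint : Integrable (Function.uncurry ψ) ((volume.restrict (Set.Ioc s t)).prod M) :=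
    Integrable.of_bound hψm.aestronglyMeasurable _ (Eventually.of_forall hψb)
  have hcongr : ∀ v ∈ Set.Ioc s t, ∫ ω, ψ v ω ∂M = ∫ ω, c ω *
      genApply (P.generator v) (P.apply v t (fun z => Φ (ω, z))) (e ω) ∂M := fun v hv => by
    simp only [ψ, hκe v hv]
  have hcongr' : (fun v => ∫ ω, ψ v ω ∂M) =ᵐ[volume.restrict (Set.Ioc s t)] fun v => ∫ ω, c ω *
      genApply (P.generator v) (P.apply v t (fun z => Φ (ω, z))) (e ω) ∂M :=
    (ae_restrict_mem measurableSet_Ioc).mono hcongr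
  refine ⟨?_, ?_⟩
  · rw [intervalIntegrable_iff_integrableOn_Ioc_of_le hst]
    exact hint.integral_prod_left.congr hcongr'
  · rw [intervalIntegral.integral_of_le hst, ← integral_congr_ae hcongr',
      integral_integral_swap hint]
    refine integral_congr_ae (Eventually.of_forall fun ω => ?_)
    simp only [ψ]
    rw [integral_const_mul]
    congr 1
    have h1 := hB.integral_eq hs hst ht (hΦ.section_right ω).toBR (e ω)
    rw [intervalIntegral.integral_of_le hst] at h1
    refine Eq.trans ?_ h1
    refine integral_congr_ae ((ae_restrict_mem measurableSet_Ioc).mono fun v hv => ?_)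
    simp only [hκe v hv]
    rfl

end TransitionSystem

end SetMarkov

namespace SetMarkov

open TransitionSystem

/-! ### Evaluation of the two sides of the generator identities -/

section Evaluation

variable {a b : ℝ} {Pf : TransitionSystem a} {Pg : TransitionSystem b} {π : ℕ → ℕ} {n : ℕ}
  {t u : ℕ → ℝ}

/-- The expectation of a functional of the second process, started at time `u 1` from the state
`x₁`, all variables up to the index `n` being integrated. -/
def pathMean (Pg : TransitionSystem b) (u : ℕ → ℝ) (n : ℕ) (F : (ℕ → ℝ) → ℝ) (x₁ : ℝ) : ℝ :=
  Pg.iter u 1 (List.range' 2 (n - 1)) F (fun _ => x₁)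

theorem iter_eq_pathMean (hu : IsPartition b n u) (hn : 1 ≤ n) {F : (ℕ → ℝ) → ℝ}
    (hF : IsBddMeas F) {S : Set ℕ} (hFS : DependsOn F S) {ls : List ℕ}
    (hls : ls.Pairwise (· ≤ ·)) (hmem : ∀ l ∈ ls, 1 ≤ l ∧ l ≤ n) (hS : ∀ s ∈ S, s ∈ ls) (x₁ : ℝ) :
    Pg.iter u 1 ls F (fun _ => x₁) = pathMean Pg u n F x₁ :=
  Pg.iter_eq_iter_range' hu hF hFS hn (List.pairwise_cons.2 ⟨fun l hl => (hmem l hl).1, hls⟩)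
    (fun l hl => (hmem l hl).2) (fun s hs _ _ => hS s hs) _

variable {i : ℕ}

theorem isBddMeas_shifted (h : BR) (x₁ : ℝ) (m : ℕ) :
    IsBddMeas fun y : ℕ → ℝ => h (x₁ + incSum π m y) :=
  (BR.isBddMeas h).comp ((measurable_incSum π m).const_add x₁)

/-- The left-hand sides of the generator identities: the integrals exist and are evaluated by the
backward equation; the operators missing in the product do not matter. -/
theorem integral_lhsIntegrand {K : ℝ} (hBf : Pf.BackwardEquation K) (hu : IsPartition b n u)
    (hπ : ∀ j, 2 ≤ j → j ≤ n → 2 ≤ π j ∧ π j ≤ n) (hi : 2 ≤ i) (hin : i ≤ n)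
    (ht0 : 0 < t (i - 1)) (ht : t (i - 1) ≤ t i) (hta : t i ≤ a) (h : ℕ → BR) (x₁ : ℝ) :
    IntervalIntegrable (lhsIntegrand π Pf Pg t u h i x₁) volume (t (i - 1)) (t i) ∧
    ∫ w in (t (i - 1))..(t i), lhsIntegrand π Pf Pg t u h i x₁ w =
      pathMean Pg u n (fun y => incProd π h (i - 1) y *
        (Pf.T (t (i - 1)) (t i) (h i) (x₁ + incSum π (i - 1) y) -
          h i (x₁ + incSum π (i - 1) y))) x₁ := by
  have hπi := hπ i hi hin
  have he : Measurable fun y : ℕ → ℝ => x₁ + incSum π (i - 1) y :=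
    (measurable_incSum π (i - 1)).const_add x₁
  have hΦ : IsBddMeas fun p : (ℕ → ℝ) × ℝ => h i p.2 := (BR.isBddMeas (h i)).comp measurable_snd
  obtain ⟨h1, h2⟩ := hBf.integral_integral ht0 ht hta hΦ he (isBddMeas_incProd π h (i - 1))
    (Pg.pathKernel u 1 (before π i ++ after π i) (fun _ => x₁))
  have hcongr : ∀ w ∈ Set.uIcc (t (i - 1)) (t i), ∫ y, incProd π h (i - 1) y *
      genApply (Pf.generator w) (Pf.apply w (t i) (fun z => h i z)) (x₁ + incSum π (i - 1) y)
        ∂(Pg.pathKernel u 1 (before π i ++ after π i) (fun _ => x₁)) =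
      lhsIntegrand π Pf Pg t u h i x₁ w := fun w hw => by
    rw [Set.uIcc_of_le ht] at hw
    rw [lhsIntegrand, Pg.iter_eq_integral u ((isBddMeas_incProd π h (i - 1)).mul
      (hBf.isBddMeas_genApply ⟨ht0.trans_le hw.1, hw.2⟩ hta hΦ he))]
  refine ⟨h1.congr fun w hw => hcongr w (Set.uIoc_subset_uIcc hw), ?_⟩
  rw [← intervalIntegral.integral_congr hcongr, h2]
  have hF : IsBddMeas fun y => incProd π h (i - 1) y *
        (Pf.T (t (i - 1)) (t i) (h i) (x₁ + incSum π (i - 1) y) -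
          h i (x₁ + incSum π (i - 1) y)) :=
    (isBddMeas_incProd π h (i - 1)).mul
      ((isBddMeas_shifted _ x₁ (i - 1)).sub (isBddMeas_shifted _ x₁ (i - 1)))
  rw [← iter_eq_pathMean hu (by omega) hF (S := incSupport π (i - 1)) (fun y y' hy => by
      beta_reduce
      rw [dependsOn_incProd π h _ hy, dependsOn_incSum π _ hy])
      (before_append_after_pairwise (π := π) hi (by omega)) (fun l hl => ?_) (fun s hs => ?_) x₁,
    Pg.iter_eq_integral u hF]
  · rfl
  · exact one_le_of_mem_incSupport hπ (m := i - 1) ((Nat.sub_le i 1).trans hin)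
      ((mem_before_append_after hi (by omega)).1 hl)
  · exact (mem_before_append_after hi (by omega)).2 hs

theorem isBddMeas_rhsBracket (h : ℕ → BR) (i : ℕ) (x₁ : ℝ) : IsBddMeas (rhsBracket π h i x₁) := by
  unfold rhsBracket
  split_ifs
  · exact (isBddMeas_incProd π h (i - 1)).mul (isBddMeas_shifted _ x₁ i)
  · exact (isBddMeas_incProd π h (i - 1)).mul
      ((isBddMeas_shifted _ x₁ i).sub (isBddMeas_shifted _ x₁ (i - 1)))

theorem dependsOn_rhsBracket (h : ℕ → BR) (i : ℕ) (x₁ : ℝ) :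
    DependsOn (rhsBracket π h i x₁) (incSupport π i) := fun y y' hy => by
  have h1 := dependsOn_incSum π i hy
  have h2 := dependsOn_incSum π (i - 1) fun s hs => hy s (incSupport_mono π (i.sub_le 1) hs)
  have h3 := dependsOn_incProd π h (i - 1) fun s hs => hy s (incSupport_mono π (i.sub_le 1) hs)
  simp only [rhsBracket, h1, h2, h3]

/-- The function `(y, z) ↦ (T_{u_{l_p} u_{l_{p+1}}} ⋯ [bracket])` at `y` with `y (π i)` replaced
by `z`. -/
def tailMean (π : ℕ → ℕ) (Pg : TransitionSystem b) (u : ℕ → ℝ) (h : ℕ → BR) (i : ℕ) (x₁ : ℝ)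
    (q : (ℕ → ℝ) × ℝ) : ℝ :=
  Pg.iter u (π i) (after π i) (rhsBracket π h i x₁) (Function.update q.1 (π i) q.2)

theorem isBddMeas_tailMean (h : ℕ → BR) (i : ℕ) (x₁ : ℝ) :
    IsBddMeas (tailMean π Pg u h i x₁) :=
  ((isBddMeas_rhsBracket h i x₁).iter (π i) (after π i)).comp measurable_update'

/-- The contribution of the term `-φ` in the backward equation `∫ 𝒢_v T_{vt} φ dv = T_{st} φ - φ`: it
corrects the bracket so that the increment of `h i` appears in both cases of its definition. -/
theorem iter_tailMean_diag (hu : IsPartition b n u)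
    (hπ : ∀ j, 2 ≤ j → j ≤ n → 2 ≤ π j ∧ π j ≤ n) (hi : 2 ≤ i) (hin : i ≤ n)
    (h : ℕ → BR) (x₁ : ℝ) :
    Pg.iter u 1 (before π i ++ [π i - 1])
        (fun y => tailMean π Pg u h i x₁ (y, y (π i - 1))) (fun _ => x₁) =
      pathMean Pg u n (fun y => rhsBracket π h i x₁ y - incProd π h (i - 1) y *
        (h i (x₁ + incSum π i y) - h i (x₁ + incSum π (i - 1) y))) x₁ := by
  have hπi := hπ i hi hin
  by_cases hp : pIndex π i = 2 * (i - 1)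
  · -- the bracket is evaluated with vanishing `i`-th increment
    have haft := (pIndex_eq_iff hi).1 hp
    have hsupp : ∀ s ∈ incSupport π (i - 1), s ∈ before π i := fun s hs => by
      have := (mem_before_append_after (π := π) hi (by omega)).2 hs
      rwa [haft, List.append_nil] at this
    have h1 : ∀ y : ℕ → ℝ, tailMean π Pg u h i x₁ (y, y (π i - 1)) =
        incProd π h (i - 1) y * h i (x₁ + incSum π (i - 1) y) := fun y => by
      have hy : ∀ s ∈ incSupport π (i - 1), Function.update y (π i) (y (π i - 1)) s = y s :=
        fun s hs => Function.update_of_ne (by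
          have := le_of_mem_before hi (by omega) (hsupp s hs)
          omega) _ _
      rw [tailMean, haft, iter, rhsBracket, if_pos hp, dependsOn_incProd π h _ hy,
        incSum_eq_add π hi, dependsOn_incSum π _ hy, Function.update_self,
        Function.update_of_ne (by omega), sub_self, add_zero]
    have h2 : ∀ y : ℕ → ℝ, rhsBracket π h i x₁ y - incProd π h (i - 1) y *
        (h i (x₁ + incSum π i y) - h i (x₁ + incSum π (i - 1) y)) =
        incProd π h (i - 1) y * h i (x₁ + incSum π (i - 1) y) := fun y => by
      rw [rhsBracket, if_pos hp]
      ring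
    simp only [h1, h2]
    refine iter_eq_pathMean hu (by omega) ((isBddMeas_incProd π h (i - 1)).mul
      (isBddMeas_shifted _ x₁ (i - 1))) (S := incSupport π (i - 1)) (fun y y' hy => by
      beta_reduce
      rw [dependsOn_incProd π h _ hy, dependsOn_incSum π _ hy])
      (before_append_pairwise hi (by omega)) (fun l hl => ?_)
      (fun s hs => List.mem_append_left _ (hsupp s hs)) x₁
    rcases List.mem_append.1 hl with hl | hl
    · exact one_le_of_mem_incSupport hπ (m := i - 1) (by omega)
        ((mem_before_append_after hi (by omega)).1 (List.mem_append_left _ hl))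
    · rw [List.mem_singleton] at hl
      omega
  · -- the bracket vanishes together with the `i`-th increment
    have hbr : ∀ y, rhsBracket π h i x₁ y = incProd π h (i - 1) y *
        (h i (x₁ + incSum π i y) - h i (x₁ + incSum π (i - 1) y)) := fun y => by
      rw [rhsBracket, if_neg hp]
    have h1 : ∀ y : ℕ → ℝ, tailMean π Pg u h i x₁ (y, y (π i - 1)) = 0 := fun y => by
      rw [tailMean, Pg.iter_eq_iter_range' hu (isBddMeas_rhsBracket h i x₁)
        (dependsOn_rhsBracket h i x₁) hπi.2 (cons_after_pairwise hi (by omega))]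
      · rw [Pg.iter_congr u (G := fun _ => 0 * 0), iter_const_mul, zero_mul]
        intro y' hy'
        rw [hbr, incSum_eq_add π hi, hy' (π i) (by simp [List.mem_range'_1]),
          hy' (π i - 1) (by simp [List.mem_range'_1]), Function.update_self,
          Function.update_of_ne (by omega), sub_self, add_zero, sub_self, mul_zero, mul_zero]
      · intro l hl
        have : l ∈ levels π i := by
          rw [levels_eq hi (by omega)]
          simp [hl]
        exact (one_le_of_mem_incSupport hπ hin ((mem_levels_iff π).1 this)).2
      · intro s hs hlt _
        have := (mem_levels_iff π).2 hs
        rw [levels_eq hi (by omega), List.mem_append, List.mem_cons, List.mem_cons] at this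
        rcases this with hm | rfl | rfl | hm
        · have := le_of_mem_before hi (by omega) hm
          omega
        · omega
        · omega
        · exact hm
    have h3 : ∀ ls : List ℕ, ∀ y, Pg.iter u 1 ls (fun _ => (0 : ℝ)) y = 0 := fun ls y => by
      have := Pg.iter_const_mul u 0 (fun _ => 0) 1 ls y
      simpa using this
    simp only [h1, hbr, sub_self]
    rw [pathMean, h3, h3]

/-- The right-hand sides of the generator identities: the integrals exist, and in both cases they
equal the expectation of the same functional. -/
theorem integral_rhsIntegrand {K : ℝ} (hBg : Pg.BackwardEquation K) (hu : IsPartition b n u)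
    (hu1 : 0 < u 1) (hπ : ∀ j, 2 ≤ j → j ≤ n → 2 ≤ π j ∧ π j ≤ n) (hi : 2 ≤ i) (hin : i ≤ n)
    (h : ℕ → BR) (x₁ : ℝ) :
    IntervalIntegrable (rhsIntegrand π Pg u h i x₁) volume (u (π i - 1)) (u (π i)) ∧
    ∫ v in (u (π i - 1))..(u (π i)), rhsIntegrand π Pg u h i x₁ v =
      pathMean Pg u n (fun y => incProd π h (i - 1) y *
        (h i (x₁ + incSum π i y) - h i (x₁ + incSum π (i - 1) y))) x₁ := by
  have hπi := hπ i hi hin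
  have hu0 : 0 < u (π i - 1) := hu1.trans_le (hu.mono (by omega) (by omega))
  have hle : u (π i - 1) ≤ u (π i) := hu.mono (by omega) hπi.2
  have hub : u (π i) ≤ b := (hu.mono hπi.2 le_rfl).trans hu.le
  have he : Measurable fun y : ℕ → ℝ => y (π i - 1) := measurable_pi_apply _
  have hΦ := isBddMeas_tailMean (π := π) (Pg := Pg) (u := u) h i x₁
  obtain ⟨h1, h2⟩ := hBg.integral_integral hu0 hle hub hΦ he (IsBddMeas.const 1)
    (Pg.pathKernel u 1 (before π i ++ [π i - 1]) (fun _ => x₁))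
  simp only [one_mul] at h1 h2
  have hcongr : ∀ v ∈ Set.uIcc (u (π i - 1)) (u (π i)), ∫ y,
      genApply (Pg.generator v) (Pg.apply v (u (π i)) (fun z => tailMean π Pg u h i x₁ (y, z)))
        (y (π i - 1)) ∂(Pg.pathKernel u 1 (before π i ++ [π i - 1]) (fun _ => x₁)) =
      rhsIntegrand π Pg u h i x₁ v := fun v hv => by
    rw [Set.uIcc_of_le hle] at hv
    exact (Pg.iter_eq_integral u
      (hBg.isBddMeas_genApply ⟨hu0.trans_le hv.1, hv.2⟩ hub hΦ he) _ _ _).symm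
  refine ⟨h1.congr fun v hv => hcongr v (Set.uIoc_subset_uIcc hv), ?_⟩
  have hdiag : IsBddMeas fun y : ℕ → ℝ => tailMean π Pg u h i x₁ (y, y (π i - 1)) :=
    hΦ.comp (measurable_id.prodMk he)
  have happ := isBddMeas_apply (P := Pg) (u (π i - 1)) (u (π i)) hΦ he
  rw [← intervalIntegral.integral_congr hcongr, h2, ← Pg.iter_eq_integral u (happ.sub hdiag),
    Pg.iter_sub u happ hdiag, iter_tailMean_diag hu hπ hi hin]
  have h3 : Pg.iter u 1 (before π i ++ [π i - 1]) (fun y => Pg.apply (u (π i - 1)) (u (π i))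
      (fun z => tailMean π Pg u h i x₁ (y, z)) (y (π i - 1))) (fun _ => x₁) =
      pathMean Pg u n (rhsBracket π h i x₁) x₁ := by
    rw [← iter_eq_pathMean hu (by omega) (isBddMeas_rhsBracket h i x₁)
      (dependsOn_rhsBracket h i x₁) (levels_pairwise π i)
      (fun l hl => one_le_of_mem_incSupport hπ hin ((mem_levels_iff π).1 hl))
      (fun s hs => (mem_levels_iff π).2 hs), levels_eq hi (by omega),
      Pg.iter_append u 1 (π i - 1) (before π i) (π i :: after π i)]
    rfl
  have hinc : IsBddMeas fun y => incProd π h (i - 1) y *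
      (h i (x₁ + incSum π i y) - h i (x₁ + incSum π (i - 1) y)) :=
    (isBddMeas_incProd π h (i - 1)).mul
      ((isBddMeas_shifted _ x₁ i).sub (isBddMeas_shifted _ x₁ (i - 1)))
  rw [h3, pathMean, pathMean, ← Pg.iter_sub u (isBddMeas_rhsBracket h i x₁)
    ((isBddMeas_rhsBracket h i x₁).sub hinc)]
  simp only [sub_sub_cancel]
  rfl

/-- The generator identity for the index `i` says that, for the second process, the `i`-th partial
sum of the permuted increments is predicted from the previous ones by the kernel
`Q^f_{t_{i-1} t_i}`. -/
theorem integral_lhs_eq_rhs_iff {K K' : ℝ} (hBf : Pf.BackwardEquation K)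
    (hBg : Pg.BackwardEquation K') (hu : IsPartition b n u) (hu1 : 0 < u 1)
    (hπ : ∀ j, 2 ≤ j → j ≤ n → 2 ≤ π j ∧ π j ≤ n) (hi : 2 ≤ i) (hin : i ≤ n)
    (ht0 : 0 < t (i - 1)) (ht : t (i - 1) ≤ t i) (hta : t i ≤ a) (h : ℕ → BR) (x₁ : ℝ) :
    ∫ w in (t (i - 1))..(t i), lhsIntegrand π Pf Pg t u h i x₁ w =
        ∫ v in (u (π i - 1))..(u (π i)), rhsIntegrand π Pg u h i x₁ v ↔
      pathMean Pg u n (fun y => incProd π h (i - 1) y *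
        Pf.T (t (i - 1)) (t i) (h i) (x₁ + incSum π (i - 1) y)) x₁ =
      pathMean Pg u n (fun y => incProd π h (i - 1) y * h i (x₁ + incSum π i y)) x₁ := by
  rw [(integral_lhsIntegrand hBf hu hπ hi hin ht0 ht hta h x₁).2,
    (integral_rhsIntegrand hBg hu hu1 hπ hi hin h x₁).2]
  have hprod := isBddMeas_incProd π h (i - 1)
  simp only [pathMean, mul_sub]
  rw [Pg.iter_sub u (hprod.mul (isBddMeas_shifted _ x₁ _)) (hprod.mul (isBddMeas_shifted _ x₁ _)),
    Pg.iter_sub u (hprod.mul (isBddMeas_shifted _ x₁ _)) (hprod.mul (isBddMeas_shifted _ x₁ _)),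
    sub_left_inj]

end Evaluation

end SetMarkov

namespace SetMarkov

open TransitionSystem

/-! ### Path laws and their increments -/

theorem integral_bind_kernel {E E' : Type*} [MeasurableSpace E] [MeasurableSpace E']
    (μ : Measure E) [IsFiniteMeasure μ] (κ : Kernel E E') [IsMarkovKernel κ] {F : E' → ℝ}
    (hF : IsBddMeas F) : ∫ y, F y ∂(μ.bind κ) = ∫ x, ∫ y, F y ∂(κ x) ∂μ := by
  have h1 : μ.bind κ = (κ ∘ₖ Kernel.const Unit μ) () := by
    rw [Kernel.comp_apply, Kernel.const_apply]
  rw [h1, Kernel.integral_comp (hF.integrable _), Kernel.const_apply]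

/-- A form of the π-λ theorem: to compare expectations of functionals of finitely many random
variables it suffices to compare the probabilities of boxes. -/
theorem integral_eq_of_integral_prod_indicator_eq {Ω : Type*} [MeasurableSpace Ω]
    {M M' : Measure Ω} [IsProbabilityMeasure M]
    [IsProbabilityMeasure M'] {V V' : Ω → ℕ → ℝ} (hV : Measurable V)
    (hV' : Measurable V') {m : ℕ}
    (H : ∀ Γ : ℕ → Set ℝ, (∀ j, MeasurableSet (Γ j)) →
      ∫ ω, ∏ j ∈ Finset.range (m + 1), (Γ j).indicator (1 : ℝ → ℝ) (V ω j) ∂M =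
        ∫ ω, ∏ j ∈ Finset.range (m + 1), (Γ j).indicator (1 : ℝ → ℝ) (V' ω j) ∂M')
    {Ψ : (ℕ → ℝ) → ℝ} (hΨ : IsBddMeas Ψ) (hΨm : DependsOn Ψ (Set.Iic m)) :
    ∫ ω, Ψ (V ω) ∂M = ∫ ω, Ψ (V' ω) ∂M' := by
  let r : (ℕ → ℝ) → (Fin (m + 1) → ℝ) := fun v j => v j
  let e : (Fin (m + 1) → ℝ) → (ℕ → ℝ) := fun w j => if h : j < m + 1 then w ⟨j, h⟩ else 0
  have hr : Measurable r := by fun_prop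
  have he : Measurable e := by
    refine measurable_pi_lambda _ fun j => ?_
    by_cases h : j < m + 1
    · simpa only [e, h, dite_true] using measurable_pi_apply _
    · simpa only [e, h, dite_false] using measurable_const
  have her : ∀ v, Ψ v = Ψ (e (r v)) := fun v => hΨm fun j hj => by
    have : j < m + 1 := Nat.lt_succ_of_le hj
    simp only [e, r, this, dite_true]
  have hbox : ∀ (M : Measure Ω) [IsProbabilityMeasure M]
      {V : Ω → ℕ → ℝ} (_ : Measurable V) (Γ : ℕ → Set ℝ) (_ : ∀ j, MeasurableSet (Γ j)),
      (M.map (r ∘ V)).real (Set.univ.pi fun j : Fin (m + 1) => Γ j) =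
        ∫ ω, ∏ j ∈ Finset.range (m + 1), (Γ j).indicator (1 : ℝ → ℝ) (V ω j) ∂M := by
    intro M _ V hV Γ hΓ
    have hs : MeasurableSet (Set.univ.pi fun j : Fin (m + 1) => Γ j) :=
      MeasurableSet.univ_pi fun j => hΓ j
    rw [map_measureReal_apply (hr.comp hV) hs, ← integral_indicator_one ((hr.comp hV) hs)]
    refine integral_congr_ae (Eventually.of_forall fun ω => ?_)
    by_cases hω : ∀ j : Fin (m + 1), V ω j ∈ Γ j
    · rw [Set.indicator_of_mem (by simpa [r] using hω)]
      refine (Finset.prod_eq_one fun j hj => ?_).symm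
      exact Set.indicator_of_mem (hω ⟨j, Finset.mem_range.1 hj⟩) _
    · rw [Set.indicator_of_notMem (by simpa [r] using hω)]
      push Not at hω
      obtain ⟨j, hj⟩ := hω
      exact (Finset.prod_eq_zero (Finset.mem_range.2 j.2) (Set.indicator_of_notMem hj _)).symm
  have hmap : M.map (r ∘ V) = M'.map (r ∘ V') := by
    have : IsProbabilityMeasure (M.map (r ∘ V)) :=
      Measure.isProbabilityMeasure_map (hr.comp hV).aemeasurable
    have : IsProbabilityMeasure (M'.map (r ∘ V')) :=
      Measure.isProbabilityMeasure_map (hr.comp hV').aemeasurable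
    refine ext_of_generate_finite _ generateFrom_pi.symm isPiSystem_pi ?_ (by simp)
    rintro _ ⟨Γ, hΓ, rfl⟩
    let Γ' : ℕ → Set ℝ := fun j => if h : j < m + 1 then Γ ⟨j, h⟩ else ∅
    have hΓ' : ∀ j, MeasurableSet (Γ' j) := fun j => by
      by_cases h : j < m + 1
      · have : MeasurableSet (Γ ⟨j, h⟩) := hΓ ⟨j, h⟩ trivial
        simpa only [Γ', h, dite_true] using this
      · simp only [Γ', h, dite_false, MeasurableSet.empty]
    have hΓe : Γ = fun j : Fin (m + 1) => Γ' j := by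
      funext j
      simp only [Γ', j.2, dite_true]
    rw [hΓe, ← measureReal_eq_measureReal_iff, hbox M hV Γ' hΓ', hbox M' hV' Γ' hΓ', H Γ' hΓ']
  have key : ∀ (M : Measure Ω) [IsProbabilityMeasure M]
      {V : Ω → ℕ → ℝ} (_ : Measurable V),
      ∫ ω, Ψ (V ω) ∂M = ∫ w, Ψ (e w) ∂(M.map (r ∘ V)) := by
    intro M _ V hV
    rw [integral_map (hr.comp hV).aemeasurable (hΨ.comp he).1.aestronglyMeasurable]
    simp only [Function.comp, ← her]
  rw [key M hV, key M' hV', hmap]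

section PathLaw

variable {a : ℝ} (P : TransitionSystem a) (u : ℕ → ℝ) (n : ℕ) (μ : Measure ℝ)

/-- The law of the values at the times `u 0, …, u n` of the process with initial distribution
`μ`. -/
def pathLaw : Measure (ℕ → ℝ) :=
  μ.bind ((P.pathKernel u 0 (List.range' 1 n)).comap (fun x _ => x)
    (measurable_pi_lambda _ fun _ => measurable_id))

variable [IsProbabilityMeasure μ]

instance : IsProbabilityMeasure (pathLaw P u n μ) := by
  unfold pathLaw
  infer_instance

variable {P u n μ}

theorem integral_pathLaw {F : (ℕ → ℝ) → ℝ} (hF : IsBddMeas F) :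
    ∫ y, F y ∂(pathLaw P u n μ) =
      ∫ x, P.iter u 0 (List.range' 1 n) F (fun _ => x) ∂μ := by
  rw [pathLaw, integral_bind_kernel _ _ hF]
  refine integral_congr_ae (Eventually.of_forall fun x => ?_)
  exact (P.iter_eq_integral u hF _ _ _).symm

theorem isBddMeas_pathMean {F : (ℕ → ℝ) → ℝ} (hF : IsBddMeas F) :
    IsBddMeas (pathMean P u n F) :=
  (hF.iter (P := P) (u := u) 1 (List.range' 2 (n - 1))).comp
    (measurable_pi_lambda _ fun _ => measurable_id)

theorem pathMean_congr {F G : (ℕ → ℝ) → ℝ} {x₁ : ℝ} (h : ∀ y, y 1 = x₁ → F y = G y) :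
    pathMean P u n F x₁ = pathMean P u n G x₁ :=
  P.iter_congr u 1 fun y hy => h y (hy 1 (by simp [List.mem_range'_1]))

/-- Conditioning on the values at the first two times. -/
theorem integral_pathLaw_mul (hn : 1 ≤ n) {F : (ℕ → ℝ) → ℝ} (hF : IsBddMeas F) {S : Set ℕ}
    (hFS : DependsOn F S) (hS : ∀ s ∈ S, 1 ≤ s ∧ s ≤ n) (c₀ c₁ : BR) :
    ∫ y, c₀ (y 0) * c₁ (y 1) * F y ∂(pathLaw P u n μ) =
      ∫ x₀, ∫ x₁, c₀ x₀ * c₁ x₁ * pathMean P u n F x₁ ∂(P.Q (u 0) (u 1) x₀) ∂μ := by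
  have hc : IsBddMeas fun y : ℕ → ℝ => c₀ (y 0) * c₁ (y 1) * F y :=
    (((BR.isBddMeas c₀).comp (measurable_pi_apply 0)).mul
      ((BR.isBddMeas c₁).comp (measurable_pi_apply 1))).mul hF
  obtain ⟨m, rfl⟩ : ∃ m, n = m + 1 := ⟨n - 1, by omega⟩
  rw [integral_pathLaw hc]
  refine integral_congr_ae (Eventually.of_forall fun x₀ => ?_)
  simp only [List.range'_succ, iter]
  refine integral_congr_ae (Eventually.of_forall fun x₁ => ?_)
  simp only
  rw [P.iter_congr u (G := fun y => (c₀ x₀ * c₁ x₁) * F y), iter_const_mul]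
  · congr 1
    refine P.iter_agree u hFS (by simp) fun s hs hsl => ?_
    have := hS s hs
    obtain rfl : s = 1 := by
      rw [List.mem_range'_1] at hsl
      omega
    simp
  · intro y hy
    rw [hy 0 (by simp [List.mem_range'_1]), hy 1 (by simp [List.mem_range'_1])]
    simp

/-- The Markov property at the time `u (i - 1)`. -/
theorem integral_pathLaw_mul_next (hu : IsPartition a n u) {i : ℕ} (hi : 2 ≤ i) (hin : i ≤ n)
    {Φ : (ℕ → ℝ) → ℝ} (hΦ : IsBddMeas Φ) (hΦi : DependsOn Φ (Set.Iic (i - 1))) (h : BR) :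
    ∫ y, Φ y * h (y i) ∂(pathLaw P u n μ) =
      ∫ y, Φ y * P.T (u (i - 1)) (u i) h (y (i - 1)) ∂(pathLaw P u n μ) := by
  obtain ⟨q, rfl⟩ : ∃ q, i = q + 2 := ⟨i - 2, by omega⟩
  have hq : q + 2 - 1 = q + 1 := rfl
  rw [hq] at hΦi ⊢
  have h1 : IsBddMeas fun y : ℕ → ℝ => Φ y * h (y (q + 2)) :=
    hΦ.mul ((BR.isBddMeas h).comp (measurable_pi_apply _))
  have h2 : IsBddMeas fun y : ℕ → ℝ => Φ y * P.T (u (q + 1)) (u (q + 2)) h (y (q + 1)) :=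
    hΦ.mul ((BR.isBddMeas _).comp (measurable_pi_apply _))
  rw [integral_pathLaw h1, integral_pathLaw h2]
  refine integral_congr_ae (Eventually.of_forall fun x₀ => ?_)
  have hsort : ∀ m, (0 :: List.range' 1 m).Pairwise (· ≤ ·) := fun m =>
    List.pairwise_cons.2 ⟨fun _ _ => Nat.zero_le _,
      (List.pairwise_lt_range' (s := 1) (n := m)).imp fun h => h.le⟩
  have e1 := P.iter_eq_iter_range' hu h1 (S := Set.Iic (q + 2)) (k := 0)
    (ls := List.range' 1 (q + 2)) (fun y y' hy => by
      beta_reduce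
      rw [hΦi fun s hs => hy s (hs.trans (Nat.le_succ _)), hy (q + 2) Set.self_mem_Iic]) (Nat.zero_le _)
    (hsort _) (fun l hl => by rw [List.mem_range'_1] at hl; omega)
    (fun s hs h0 _ => by rw [List.mem_range'_1]; rw [Set.mem_Iic] at hs; omega) (fun _ => x₀)
  have e2 := P.iter_eq_iter_range' hu h2 (S := Set.Iic (q + 1)) (k := 0)
    (ls := List.range' 1 (q + 1)) (fun y y' hy => by
      beta_reduce
      rw [hΦi hy, hy (q + 1) Set.self_mem_Iic]) (Nat.zero_le _)
    (hsort _) (fun l hl => by rw [List.mem_range'_1] at hl; omega)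
    (fun s hs h0 _ => by rw [List.mem_range'_1]; rw [Set.mem_Iic] at hs; omega) (fun _ => x₀)
  rw [zero_add, Nat.sub_zero] at e1 e2
  beta_reduce
  have l1 : List.range' 1 (q + 1) = List.range' 1 q ++ [q + 1] := by
    rw [List.range'_concat]; simp [add_comm]
  have l2 : List.range' 1 (q + 2) = List.range' 1 q ++ (q + 1) :: [q + 2] := by
    rw [List.range'_concat, l1]; simp; omega
  rw [← e1, ← e2, l1, l2, iter_append]
  congr 1
  funext y
  simp only [iter, T_apply, ← integral_const_mul]
  refine integral_congr_ae (Eventually.of_forall fun z => ?_)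
  simp only [Function.update_self]
  congr 1
  refine hΦi fun s hs => Function.update_of_ne ?_ _ _
  rw [Set.mem_Iic] at hs
  omega

end PathLaw

/-! ### The partial sums of the permuted increments -/

section Increments

variable (π : ℕ → ℕ)

/-- The sequence `y 0, y 1, y (π 2) - y (π 2 - 1), y (π 3) - y (π 3 - 1), …`. -/
def inc (y : ℕ → ℝ) (j : ℕ) : ℝ := if j ≤ 1 then y j else y (π j) - y (π j - 1)

/-- The partial sum `y 1 + ∑_{j=2}^{m} (y (π j) - y (π j - 1))`. -/
def partialSum (m : ℕ) (y : ℕ → ℝ) : ℝ := y 1 + incSum π m y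

theorem measurable_inc : Measurable (inc π) := by
  refine measurable_pi_lambda _ fun j => ?_
  unfold inc
  split_ifs <;> fun_prop

theorem measurable_partialSum (m : ℕ) : Measurable (partialSum π m) :=
  (measurable_pi_apply 1).add (measurable_incSum π m)

theorem partialSum_id {m : ℕ} (hm : 1 ≤ m) (y : ℕ → ℝ) : partialSum id m y = y m := by
  induction m, hm using Nat.le_induction with
  | base => simp [partialSum, incSum]
  | succ m hm ih =>
    rw [partialSum] at ih ⊢
    rw [incSum_eq_add id (by omega), ← add_assoc, Nat.add_sub_cancel, ih]
    simp

theorem prod_range_inc {m : ℕ} (hm : 1 ≤ m) (φ : ℕ → ℝ → ℝ) (y : ℕ → ℝ) :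
    ∏ j ∈ Finset.range (m + 1), φ j (inc π y j) =
      φ 0 (y 0) * φ 1 (y 1) * ∏ j ∈ Finset.Icc 2 m, φ j (y (π j) - y (π j - 1)) := by
  induction m, hm using Nat.le_induction with
  | base => simp [Finset.prod_range_succ, inc]
  | succ m hm ih =>
    rw [Finset.prod_range_succ, ih, Finset.prod_Icc_succ_top (by omega), inc, if_neg (by omega),
      mul_assoc]

theorem partialSum_eq_inc (m : ℕ) (y : ℕ → ℝ) :
    partialSum π m y = inc π y 1 + ∑ j ∈ Finset.Icc 2 m, inc π y j := by
  rw [partialSum, incSum]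
  congr 1
  refine Finset.sum_congr rfl fun j hj => ?_
  rw [Finset.mem_Icc] at hj
  rw [inc, if_neg (by omega)]

/-- The functional of the paths which occurs in the generator identities, with additional functions
of the first two variables. -/
def testFun (c₀ c₁ : BR) (h : ℕ → BR) (k : ℕ) (g : BR) (m : ℕ) (y : ℕ → ℝ) : ℝ :=
  c₀ (y 0) * c₁ (y 1) * (incProd π h k y * g (partialSum π m y))

theorem isBddMeas_incProd_mul (h : ℕ → BR) (k : ℕ) (g : BR) (m : ℕ) :
    IsBddMeas fun y => incProd π h k y * g (partialSum π m y) :=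
  (isBddMeas_incProd π h k).mul ((BR.isBddMeas g).comp (measurable_partialSum π m))

theorem isBddMeas_testFun (c₀ c₁ : BR) (h : ℕ → BR) (k : ℕ) (g : BR) (m : ℕ) :
    IsBddMeas (testFun π c₀ c₁ h k g m) :=
  (((BR.isBddMeas c₀).comp (measurable_pi_apply 0)).mul
    ((BR.isBddMeas c₁).comp (measurable_pi_apply 1))).mul (isBddMeas_incProd_mul π h k g m)

/-- The increments numbered `0, …, m` along `π` under `M` and along `π'` under `M'` have the same
joint distribution. -/
def SameIncrements (M M' : Measure (ℕ → ℝ)) (π π' : ℕ → ℕ) (m : ℕ) : Prop :=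
  ∀ Ψ : (ℕ → ℝ) → ℝ, IsBddMeas Ψ → DependsOn Ψ (Set.Iic m) →
    ∫ y, Ψ (inc π y) ∂M = ∫ y, Ψ (inc π' y) ∂M'

theorem SameIncrements.mono {M M' : Measure (ℕ → ℝ)} {π π' : ℕ → ℕ} {m k : ℕ}
    (H : SameIncrements M M' π π' m) (hk : k ≤ m) : SameIncrements M M' π π' k :=
  fun Ψ h1 h2 => H Ψ h1 fun _ _ hxy => h2 fun s hs => hxy s (hs.trans hk)

theorem SameIncrements.integral_testFun {M M' : Measure (ℕ → ℝ)} {π π' : ℕ → ℕ} {i k m : ℕ}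
    (H : SameIncrements M M' π π' i) (hi : 1 ≤ i) (hk : k ≤ i) (hm : m ≤ i) (c₀ c₁ : BR)
    (h : ℕ → BR) (g : BR) :
    ∫ y, testFun π c₀ c₁ h k g m y ∂M = ∫ y, testFun π' c₀ c₁ h k g m y ∂M' := by
  let Ψ : (ℕ → ℝ) → ℝ := fun v => c₀ (v 0) * c₁ (v 1) *
    ((∏ j ∈ Finset.Icc 2 k, h j (v j)) * g (v 1 + ∑ j ∈ Finset.Icc 2 m, v j))
  have hΨ : ∀ (π : ℕ → ℕ) y, testFun π c₀ c₁ h k g m y = Ψ (inc π y) := fun π y => by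
    have : incProd π h k y = ∏ j ∈ Finset.Icc 2 k, h j (inc π y j) :=
      Finset.prod_congr rfl fun j hj => by
        rw [Finset.mem_Icc] at hj
        rw [inc, if_neg (by omega)]
    simp only [testFun, Ψ, this, partialSum_eq_inc]
    rfl
  simp only [hΨ]
  refine H Ψ ?_ fun v w hvw => ?_
  · refine (((BR.isBddMeas c₀).comp (measurable_pi_apply 0)).mul
      ((BR.isBddMeas c₁).comp (measurable_pi_apply 1))).mul (IsBddMeas.mul
      (IsBddMeas.finset_prod _ fun j => (BR.isBddMeas (h j)).comp (measurable_pi_apply j))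
      ((BR.isBddMeas g).comp (by fun_prop)))
  · have h1 : ∏ j ∈ Finset.Icc 2 k, h j (v j) = ∏ j ∈ Finset.Icc 2 k, h j (w j) :=
      Finset.prod_congr rfl fun j hj => by
        rw [hvw j ((Finset.mem_Icc.1 hj).2.trans hk)]
    have h2 : ∑ j ∈ Finset.Icc 2 m, v j = ∑ j ∈ Finset.Icc 2 m, w j :=
      Finset.sum_congr rfl fun j hj => hvw j ((Finset.mem_Icc.1 hj).2.trans hm)
    simp only [Ψ, h1, h2, hvw 0 (Nat.zero_le _), hvw 1 hi]

/-- Replacing the last increment by the partial sum does not lose information. -/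
theorem sameIncrements_of_integral_testFun {M M' : Measure (ℕ → ℝ)} [IsProbabilityMeasure M]
    [IsProbabilityMeasure M'] {π π' : ℕ → ℕ} {i : ℕ} (hi : 2 ≤ i)
    (H : ∀ (c₀ c₁ : BR) (h : ℕ → BR), ∫ y, testFun π c₀ c₁ h (i - 1) (h i) i y ∂M =
      ∫ y, testFun π' c₀ c₁ h (i - 1) (h i) i y ∂M') : SameIncrements M M' π π' i := by
  intro Ψ hΨ hΨi
  let V : (ℕ → ℕ) → (ℕ → ℝ) → ℕ → ℝ := fun π y => Function.update (inc π y) i (partialSum π i y)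
  have hV : ∀ π, Measurable (V π) := fun π =>
    measurable_update'.comp ((measurable_inc π).prodMk (measurable_partialSum π i))
  let Θ : (ℕ → ℝ) → ℕ → ℝ := fun w =>
    Function.update w i (w i - (w 1 + ∑ j ∈ Finset.Icc 2 (i - 1), w j))
  have hΘ : Measurable Θ := measurable_update'.comp (measurable_id.prodMk (by fun_prop))
  have hΘV : ∀ π y, Θ (V π y) = inc π y := fun π y => by
    have h1 : V π y 1 + ∑ j ∈ Finset.Icc 2 (i - 1), V π y j = partialSum π (i - 1) y := by
      rw [partialSum_eq_inc]
      congr 1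
      · exact Function.update_of_ne (by omega) _ _
      · refine Finset.sum_congr rfl fun j hj => Function.update_of_ne ?_ _ _
        rw [Finset.mem_Icc] at hj
        omega
    simp only [Θ]
    rw [h1]
    simp only [V, Function.update_self, Function.update_idem]
    rw [partialSum, partialSum, incSum_eq_add π hi]
    have h2 : inc π y i = y (π i) - y (π i - 1) := by rw [inc, if_neg (by omega)]
    have h3 : y 1 + (incSum π (i - 1) y + (y (π i) - y (π i - 1))) -
      (y 1 + incSum π (i - 1) y) = inc π y i := by rw [h2]; ring
    rw [h3, Function.update_eq_self]
  have := integral_eq_of_integral_prod_indicator_eq (M := M) (M' := M') (hV π) (hV π') (m := i)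
    (Ψ := fun w => Ψ (Θ w)) ?_ (hΨ.comp hΘ) ?_
  · simpa only [hΘV] using this
  · intro Γ hΓ
    have hprod : ∀ π y, ∏ j ∈ Finset.range (i + 1), (Γ j).indicator (1 : ℝ → ℝ) (V π y j) =
        testFun π (BR.ind (Γ 0) (hΓ 0)) (BR.ind (Γ 1) (hΓ 1)) (fun j => BR.ind (Γ j) (hΓ j))
          (i - 1) (BR.ind (Γ i) (hΓ i)) i y := fun π y => by
      obtain ⟨m, rfl⟩ : ∃ m, i = m + 1 := ⟨i - 1, by omega⟩
      rw [Finset.prod_range_succ]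
      have h1 : ∏ j ∈ Finset.range (m + 1), (Γ j).indicator (1 : ℝ → ℝ) (V π y j) =
          ∏ j ∈ Finset.range (m + 1), (Γ j).indicator (1 : ℝ → ℝ) (inc π y j) :=
        Finset.prod_congr rfl fun j hj => by
          rw [Finset.mem_range] at hj
          simp only [V]
          rw [Function.update_of_ne (by omega)]
      rw [h1, prod_range_inc π (by omega) (fun j => (Γ j).indicator 1), mul_assoc]
      simp only [V, Function.update_self]
      rfl
    simp only [hprod]
    exact H _ _ fun j => BR.ind (Γ j) (hΓ j)
  · intro v w hvw
    refine hΨi fun s hs => ?_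
    simp only [Θ]
    have h2 : ∑ j ∈ Finset.Icc 2 (i - 1), v j = ∑ j ∈ Finset.Icc 2 (i - 1), w j :=
      Finset.sum_congr rfl fun j hj =>
        hvw j ((Finset.mem_Icc.1 hj).2.trans (Nat.sub_le _ _))
    rw [h2, hvw i Set.self_mem_Iic, hvw 1 (show 1 ≤ i by omega)]
    by_cases hsi : s = i
    · simp [hsi]
    · rw [Function.update_of_ne hsi, Function.update_of_ne hsi, hvw s hs]

end Increments

end SetMarkov

namespace SetMarkov

open TransitionSystem

/-! ### The equivalence -/

section Equivalence

theorem tendsto_integral_testFun (M : Measure (ℕ → ℝ)) [IsProbabilityMeasure M] (π : ℕ → ℕ)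
    (c₀ c₁ : BR) {H : ℕ → ℕ → BR} {h : ℕ → BR} (hH : ∀ j, Tendsto (fun q => H q j) atTop (𝓝 (h j)))
    {G : ℕ → BR} {g : BR} (hG : Tendsto G atTop (𝓝 g)) (k m : ℕ) :
    Tendsto (fun q => ∫ y, testFun π c₀ c₁ (H q) k (G q) m y ∂M) atTop
      (𝓝 (∫ y, testFun π c₀ c₁ h k g m y ∂M)) := by
  have hbd : ∀ {F : ℕ → BR} {f : BR}, Tendsto F atTop (𝓝 f) → ∃ C, ∀ q, ‖F q‖ ≤ C := fun hF => by
    obtain ⟨C, hC⟩ := hF.norm.bddAbove_range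
    exact ⟨C, fun q => hC ⟨q, rfl⟩⟩
  choose B hB using fun j => hbd (hH j)
  obtain ⟨C, hC⟩ := hbd hG
  refine tendsto_integral_of_dominated_convergence
    (fun _ => ‖c₀‖ * ‖c₁‖ * ((∏ j ∈ Finset.Icc 2 k, B j) * C))
    (fun q => (isBddMeas_testFun π c₀ c₁ (H q) k (G q) m).1.aestronglyMeasurable)
    (integrable_const _) (fun q => Eventually.of_forall fun y => ?_)
    (Eventually.of_forall fun y => ?_)
  · rw [testFun, norm_mul, norm_mul, norm_mul, incProd, norm_prod]
    have h0 : ∏ j ∈ Finset.Icc 2 k, ‖H q j (y (π j) - y (π j - 1))‖ ≤ ∏ j ∈ Finset.Icc 2 k, B j :=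
      Finset.prod_le_prod (fun _ _ => norm_nonneg _)
        fun j _ => (BR.abs_le_norm _ _).trans (hB j q)
    have h1 : ‖G q (partialSum π m y)‖ ≤ C := (BR.abs_le_norm _ _).trans (hC q)
    have h2 : 0 ≤ ∏ j ∈ Finset.Icc 2 k, B j :=
      Finset.prod_nonneg fun j _ => (norm_nonneg _).trans (hB j 0)
    exact mul_le_mul (mul_le_mul (BR.abs_le_norm _ _) (BR.abs_le_norm _ _) (norm_nonneg _)
      (norm_nonneg _)) (mul_le_mul h0 h1 (norm_nonneg _) h2)
      (mul_nonneg (Finset.prod_nonneg fun _ _ => norm_nonneg _) (norm_nonneg _))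
      (mul_nonneg (norm_nonneg _) (norm_nonneg _))
  · have h1 : Tendsto (fun q => incProd π (H q) k y) atTop (𝓝 (incProd π h k y)) :=
      tendsto_finsetProd _ fun j _ => BR.tendsto_apply (hH j) (y (π j) - y (π j - 1))
    have h2 := BR.tendsto_apply hG (partialSum π m y)
    exact (h1.mul h2).const_mul (c₀ (y 0) * c₁ (y 1))

variable {a b : ℝ} {Pf : TransitionSystem a} {Pg : TransitionSystem b} {π : ℕ → ℕ} {n : ℕ}
  {t u : ℕ → ℝ} {μ : Measure ℝ} [IsProbabilityMeasure μ]

/-- The law of the permuted increments is compared with the law of the increments of the first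
process, for which the permutation is the identity. -/
theorem integralCondition_iff (hn : 1 ≤ n) : IntegralCondition Pf Pg μ n π t u ↔
    SameIncrements (pathLaw Pf t n μ) (pathLaw Pg u n μ) id π n := by
  have hF : ∀ (π : ℕ → ℕ) {Γ : ℕ → Set ℝ}, (∀ j, MeasurableSet (Γ j)) → IsBddMeas
      fun y : ℕ → ℝ => (Γ 0).indicator (1 : ℝ → ℝ) (y 0) * (Γ 1).indicator 1 (y 1) *
        ∏ i ∈ Finset.Icc 2 n, (Γ i).indicator 1 (y (π i) - y (π i - 1)) := fun π Γ hΓ =>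
    (((IsBddMeas.indicator_one (hΓ 0)).comp (measurable_pi_apply 0)).mul
      ((IsBddMeas.indicator_one (hΓ 1)).comp (measurable_pi_apply 1))).mul
      (IsBddMeas.finset_prod _ fun j => (IsBddMeas.indicator_one (hΓ j)).comp (by fun_prop))
  have hprod : ∀ {c : ℝ} (P : TransitionSystem c) (t : ℕ → ℝ) (π : ℕ → ℕ) {Γ : ℕ → Set ℝ},
      (∀ j, MeasurableSet (Γ j)) →
      ∫ x₀, P.iter t 0 (List.range' 1 n)
        (fun y => (Γ 0).indicator 1 (y 0) * (Γ 1).indicator 1 (y 1) *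
          ∏ i ∈ Finset.Icc 2 n, (Γ i).indicator 1 (y (π i) - y (π i - 1))) (fun _ => x₀) ∂μ =
      ∫ y, ∏ j ∈ Finset.range (n + 1), (Γ j).indicator (1 : ℝ → ℝ) (inc π y j)
        ∂(pathLaw P t n μ) := fun P t π Γ hΓ => by
    simp only [prod_range_inc π hn (fun j => (Γ j).indicator 1)]
    exact (integral_pathLaw (hF π hΓ)).symm
  constructor
  · intro H Ψ hΨ hΨn
    refine integral_eq_of_integral_prod_indicator_eq (measurable_inc id) (measurable_inc π)
      (fun Γ hΓ => ?_) hΨ hΨn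
    rw [← hprod Pf t id hΓ, ← hprod Pg u π hΓ]
    exact H Γ hΓ
  · intro H Γ hΓ
    have h1 := hprod Pf t id hΓ
    have h2 := hprod Pg u π hΓ
    refine (h1.trans (H (fun v => ∏ j ∈ Finset.range (n + 1), (Γ j).indicator 1 (v j))
      (IsBddMeas.finset_prod _ fun j =>
        (IsBddMeas.indicator_one (hΓ j)).comp (measurable_pi_apply j))
      fun v w hvw => Finset.prod_congr rfl fun j hj => ?_)).trans h2.symm
    rw [hvw j (Nat.lt_succ_iff.1 (Finset.mem_range.1 hj))]

theorem integral_testFun_pathLaw (hn : 1 ≤ n)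
    (hπ : ∀ j, 2 ≤ j → j ≤ n → 2 ≤ π j ∧ π j ≤ n) {k m : ℕ} (hk : k ≤ n) (hm : m ≤ n)
    (c₀ c₁ : BR) (h : ℕ → BR) (g : BR) :
    ∫ y, testFun π c₀ c₁ h k g m y ∂(pathLaw Pg u n μ) =
      ∫ x₀, ∫ x₁, c₀ x₀ * c₁ x₁ * pathMean Pg u n
        (fun y => incProd π h k y * g (partialSum π m y)) x₁ ∂(Pg.Q (u 0) (u 1) x₀) ∂μ := by
  refine integral_pathLaw_mul hn (isBddMeas_incProd_mul π h k g m)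
    (S := insert 1 (incSupport π n)) (fun y y' hy => ?_) (fun s hs => ?_) c₀ c₁
  · have h1 := hy 1 (Set.mem_insert _ _)
    have h2 : ∀ l ≤ n, ∀ s ∈ incSupport π l, y s = y' s := fun l hl s hs =>
      hy s (Set.mem_insert_of_mem _ (incSupport_mono π hl hs))
    simp only [partialSum, dependsOn_incProd π h k (h2 k hk), dependsOn_incSum π m (h2 m hm), h1]
  · rcases hs with rfl | hs
    · exact ⟨le_rfl, hn⟩
    · exact one_le_of_mem_incSupport hπ le_rfl hs

/-- The Markov property of the first process, in terms of its increments. -/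
theorem integral_testFun_id_next (ht : IsPartition a n t) {i : ℕ} (hi : 2 ≤ i) (hin : i ≤ n)
    (c₀ c₁ : BR) (h : ℕ → BR) (g : BR) :
    ∫ y, testFun id c₀ c₁ h (i - 1) (Pf.T (t (i - 1)) (t i) g) (i - 1) y ∂(pathLaw Pf t n μ) =
      ∫ y, testFun id c₀ c₁ h (i - 1) g i y ∂(pathLaw Pf t n μ) := by
  have hΦ : IsBddMeas fun y : ℕ → ℝ => c₀ (y 0) * c₁ (y 1) * incProd id h (i - 1) y :=
    (((BR.isBddMeas c₀).comp (measurable_pi_apply 0)).mul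
      ((BR.isBddMeas c₁).comp (measurable_pi_apply 1))).mul (isBddMeas_incProd id h (i - 1))
  have hΦi : DependsOn (fun y : ℕ → ℝ => c₀ (y 0) * c₁ (y 1) * incProd id h (i - 1) y)
      (Set.Iic (i - 1)) := fun y y' hy => by
    have h1 : ∀ s ∈ incSupport id (i - 1), y s = y' s := by
      rintro s ⟨j, h2, h3, h4⟩
      refine hy s (Set.mem_Iic.2 ?_)
      simp only [id] at h4
      omega
    simp only [dependsOn_incProd id h (i - 1) h1, hy 0 (Set.mem_Iic.2 (Nat.zero_le _)),
      hy 1 (Set.mem_Iic.2 (by omega))]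
  have := integral_pathLaw_mul_next (P := Pf) (μ := μ) ht hi hin hΦ hΦi g
  simp only [testFun, partialSum_id (show 1 ≤ i by omega),
    partialSum_id (show 1 ≤ i - 1 by omega), ← mul_assoc]
  exact this.symm

/-- The `i`-th permuted partial sum of the second process is predicted from the previous ones by the
kernel `Q^f_{t_{i-1} t_i}`, tested with the functions `c₀, c₁, h 2, …, h i`. -/
def Predicts (Pf : TransitionSystem a) (t : ℕ → ℝ) (M : Measure (ℕ → ℝ)) (π : ℕ → ℕ) (i : ℕ)
    (c₀ c₁ : BR) (h : ℕ → BR) : Prop :=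
  ∫ y, testFun π c₀ c₁ h (i - 1) (Pf.T (t (i - 1)) (t i) (h i)) (i - 1) y ∂M =
    ∫ y, testFun π c₀ c₁ h (i - 1) (h i) i y ∂M

theorem predicts_of_dense {D : Submodule ℝ BR} (hD : Dense (D : Set BR)) {M : Measure (ℕ → ℝ)}
    [IsProbabilityMeasure M] {i : ℕ} {c₀ c₁ : BR}
    (H : ∀ h : ℕ → BR, (∀ j, h j ∈ D) → Predicts Pf t M π i c₀ c₁ h) (h : ℕ → BR) :
    Predicts Pf t M π i c₀ c₁ h := by
  choose F hFD hF using fun j => mem_closure_iff_seq_limit.1 (hD (h j))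
  have hT : Tendsto (fun q => Pf.T (t (i - 1)) (t i) (F i q)) atTop
      (𝓝 (Pf.T (t (i - 1)) (t i) (h i))) := by
    have h1 := hF i
    rw [tendsto_iff_norm_sub_tendsto_zero] at h1 ⊢
    refine squeeze_zero (fun _ => norm_nonneg _) (fun q => ?_) h1
    rw [← map_sub]
    exact Pf.norm_T_le _ _ _
  have h1 := tendsto_integral_testFun M π c₀ c₁ (H := fun q j => F j q) hF hT (i - 1) (i - 1)
  have h2 := tendsto_integral_testFun M π c₀ c₁ (H := fun q j => F j q) hF (hF i) (i - 1) i
  refine tendsto_nhds_unique h1 (h2.congr fun q => ?_)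
  exact (H (fun j => F j q) fun j => hFD j q).symm

/-- Conditioning on the initial values turns the integrated prediction identities into an identity
for almost every value at the first time. -/
theorem ae_pathMean_eq_iff (hn : 1 ≤ n) (hπ : ∀ j, 2 ≤ j → j ≤ n → 2 ≤ π j ∧ π j ≤ n)
    (hQ : ∀ x, Pf.Q (t 0) (t 1) x = Pg.Q (u 0) (u 1) x) {i : ℕ} (hin : i ≤ n) (h : ℕ → BR) :
    (∀ᵐ x₁ ∂(μ.bind (Pf.Q (t 0) (t 1))),
      pathMean Pg u n (fun y => incProd π h (i - 1) y *
        Pf.T (t (i - 1)) (t i) (h i) (x₁ + incSum π (i - 1) y)) x₁ =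
      pathMean Pg u n (fun y => incProd π h (i - 1) y * h i (x₁ + incSum π i y)) x₁) ↔
    ∀ c₀ c₁, Predicts Pf t (pathLaw Pg u n μ) π i c₀ c₁ h := by
  have hshift : ∀ (g : BR) (m : ℕ) (x₁ : ℝ),
      pathMean Pg u n (fun y => incProd π h (i - 1) y * g (x₁ + incSum π m y)) x₁ =
        pathMean Pg u n (fun y => incProd π h (i - 1) y * g (partialSum π m y)) x₁ :=
    fun g m x₁ => pathMean_congr fun y hy => by rw [partialSum, hy]
  simp only [hshift, Predicts]
  have hi1 : i - 1 ≤ n := (Nat.sub_le _ _).trans hin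
  simp only [integral_testFun_pathLaw hn hπ hi1 hi1, integral_testFun_pathLaw hn hπ hi1 hin, ← hQ]
  set A := pathMean Pg u n
    (fun y => incProd π h (i - 1) y * Pf.T (t (i - 1)) (t i) (h i) (partialSum π (i - 1) y))
  set B := pathMean Pg u n (fun y => incProd π h (i - 1) y * h i (partialSum π i y))
  have hA : IsBddMeas A := isBddMeas_pathMean (isBddMeas_incProd_mul π h _ _ _)
  have hB : IsBddMeas B := isBddMeas_pathMean (isBddMeas_incProd_mul π h _ _ _)
  constructor
  · intro H c₀ c₁
    have H' := Measure.ae_ae_of_ae_bind (Pf.Q (t 0) (t 1)).aemeasurable H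
    refine integral_congr_ae (H'.mono fun x₀ hx₀ => integral_congr_ae (hx₀.mono fun x₁ hx₁ => ?_))
    simp only [hx₁]
  · intro H
    refine (hA.integrable _).ae_eq_of_forall_setIntegral_eq _ _ (hB.integrable _)
      fun Γ hΓ _ => ?_
    have h1 := H (BR.ind Set.univ MeasurableSet.univ) (BR.ind Γ hΓ)
    have h2 : ∀ {F : ℝ → ℝ}, IsBddMeas F → ∫ x₁ in Γ, F x₁ ∂(μ.bind (Pf.Q (t 0) (t 1))) =
        ∫ x₀, ∫ x₁, BR.ind Set.univ MeasurableSet.univ x₀ * BR.ind Γ hΓ x₁ * F x₁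
          ∂(Pf.Q (t 0) (t 1) x₀) ∂μ := fun {F} hF => by
      have h3 : ∀ x, Γ.indicator F x = Γ.indicator (1 : ℝ → ℝ) x * F x := fun x => by
        by_cases hx : x ∈ Γ <;> simp [hx]
      rw [← integral_indicator hΓ]
      simp only [h3, BR.ind, BR.mk_apply, Set.indicator_univ, Pi.one_apply, one_mul]
      exact integral_bind_kernel μ _ ((IsBddMeas.indicator_one hΓ).mul hF)
    rw [h2 hA, h2 hB]
    exact h1

theorem sameIncrements_one (hn : 1 ≤ n)
    (hQ : ∀ x, Pf.Q (t 0) (t 1) x = Pg.Q (u 0) (u 1) x) :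
    SameIncrements (pathLaw Pf t n μ) (pathLaw Pg u n μ) id π 1 := by
  intro Ψ hΨ hΨ1
  refine integral_eq_of_integral_prod_indicator_eq (measurable_inc id) (measurable_inc π)
    (fun Γ hΓ => ?_) hΨ hΨ1
  have hone : IsBddMeas fun _ : ℕ → ℝ => (1 : ℝ) := IsBddMeas.const 1
  have hmean : ∀ {c : ℝ} (P : TransitionSystem c) (t : ℕ → ℝ) (x : ℝ),
      pathMean P t n (fun _ => 1) x = 1 := fun P t x => by
    rw [pathMean, P.iter_eq_integral t hone]
    simp
  have key : ∀ {c : ℝ} (P : TransitionSystem c) (t : ℕ → ℝ) (π : ℕ → ℕ),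
      ∫ y, ∏ j ∈ Finset.range (1 + 1), (Γ j).indicator (1 : ℝ → ℝ) (inc π y j)
        ∂(pathLaw P t n μ) = ∫ x₀, ∫ x₁, BR.ind (Γ 0) (hΓ 0) x₀ * BR.ind (Γ 1) (hΓ 1) x₁ * 1
          ∂(P.Q (t 0) (t 1) x₀) ∂μ := fun P t π => by
    have h1 := integral_pathLaw_mul (P := P) (u := t) (μ := μ) hn hone (S := ∅)
      (fun _ _ _ => rfl) (by simp) (BR.ind (Γ 0) (hΓ 0)) (BR.ind (Γ 1) (hΓ 1))
    simp only [hmean] at h1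
    rw [← h1]
    refine integral_congr_ae (Eventually.of_forall fun y => ?_)
    simp only [prod_range_inc π le_rfl (fun j => (Γ j).indicator (1 : ℝ → ℝ))]
    simp [BR.ind]
  rw [key Pf t id, key Pg u π]
  simp only [hQ]

/-- The increments have the same law if and only if every partial sum is predicted correctly from
the previous ones: the latter determines the laws step by step. -/
theorem sameIncrements_iff (hn : 1 ≤ n) (ht : IsPartition a n t)
    (hQ : ∀ x, Pf.Q (t 0) (t 1) x = Pg.Q (u 0) (u 1) x) :
    SameIncrements (pathLaw Pf t n μ) (pathLaw Pg u n μ) id π n ↔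
      ∀ i, 2 ≤ i → i ≤ n → ∀ c₀ c₁ h, Predicts Pf t (pathLaw Pg u n μ) π i c₀ c₁ h := by
  constructor
  · intro H i hi hin c₀ c₁ h
    rw [Predicts, ← H.integral_testFun hn (by omega) (by omega),
      ← H.integral_testFun hn (by omega) hin, integral_testFun_id_next ht hi hin]
  · intro H
    have key : ∀ m, 1 ≤ m → m ≤ n →
        SameIncrements (pathLaw Pf t n μ) (pathLaw Pg u n μ) id π m := by
      intro m hm
      induction m, hm using Nat.le_induction with
      | base => exact fun _ => sameIncrements_one hn hQ
      | succ m hm ih =>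
        intro hmn
        refine sameIncrements_of_integral_testFun (by omega) fun c₀ c₁ h => ?_
        have h1 := H (m + 1) (by omega) hmn c₀ c₁ h
        rw [Predicts] at h1
        rw [← h1, ← integral_testFun_id_next ht (by omega) hmn]
        exact (ih (by omega)).integral_testFun hm le_rfl le_rfl _ _ _ _
    exact key n hn le_rfl

end Equivalence

theorem Connects.isPartition {X : Type*} [TopologicalSpace X] [CompactSpace X] [T2Space X]
    [Nonempty X] {𝒜 : IndexingCollection X} {n : ℕ} {A : ℕ → Set X} {a : ℝ} {t : ℕ → ℝ}
    {f : ℝ → Set X} (hf : Connects 𝒜 n A a t f) : IsPartition a n t where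
  mono := fun hij hjn => hf.t_strictMono.monotoneOn ⟨Nat.zero_le _, hij.trans hjn⟩
    ⟨Nat.zero_le _, hjn⟩ hij
  nonneg := hf.t_zero.ge
  le := hf.t_last.le

end SetMarkov

end

theorem lemma6 {X : Type*} [TopologicalSpace X] [CompactSpace X] [T2Space X] [Nonempty X]
    (𝒜 : SetMarkov.IndexingCollection X) (𝒮 : Set (Set X)) (n : ℕ) (A A' : ℕ → Set X)
    (hA : SetMarkov.IsConsistentOrdering 𝒜 𝒮 n A)
    (hA' : SetMarkov.IsConsistentOrdering 𝒜 𝒮 n A')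
    (π : ℕ → ℕ) (hπ : Set.BijOn π (Set.Icc 1 n) (Set.Icc 1 n)) (hπ1 : π 1 = 1)
    (hAA' : ∀ i ∈ Set.Icc 1 n, A i = A' (π i))
    (a b : ℝ) (t u : ℕ → ℝ) (f g : ℝ → Set X)
    (hf : SetMarkov.Connects 𝒜 n A a t f) (hg : SetMarkov.Connects 𝒜 n A' b u g)
    (Pf : SetMarkov.TransitionSystem a) (Pg : SetMarkov.TransitionSystem b)
    (μ : MeasureTheory.Measure ℝ) [MeasureTheory.IsProbabilityMeasure μ]
    (D : Submodule ℝ SetMarkov.BR) (hD : Dense (D : Set SetMarkov.BR))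
    (hDf : Pf.IsRegularOn D) (hDg : Pg.IsRegularOn D)
    (h01 : ∀ x, Pf.Q 0 (t 1) x = Pg.Q 0 (u 1) x) :
    (∀ i, 2 ≤ i → i ≤ n → ∀ h : ℕ → SetMarkov.BR, (∀ j, 2 ≤ j → j ≤ i → h j ∈ D) →
      ∀ x₁, SetMarkov.IdentityDefined π Pf Pg t u h i x₁) ∧
    (SetMarkov.IntegralCondition Pf Pg μ n π t u ↔
      SetMarkov.GeneratorCondition π Pf Pg t u D μ n) := by
  have hn : 1 ≤ n := by
    obtain ⟨B, hB⟩ := hA.semilattice.2.2.1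
    obtain ⟨j, hj, -⟩ := hA.bijOn.surjOn hB
    exact hj.1.trans hj.2
  have hπ2 : ∀ j, 2 ≤ j → j ≤ n → 2 ≤ π j ∧ π j ≤ n := fun j hj hjn => by
    have h1 := hπ.mapsTo (x := j) ⟨by omega, hjn⟩
    have h2 : π j ≠ 1 := fun h => by
      have := hπ.injOn (show j ∈ Set.Icc 1 n from ⟨by omega, hjn⟩)
        (show 1 ∈ Set.Icc 1 n from ⟨le_rfl, hn⟩) (h.trans hπ1.symm)
      omega
    have h3 := h1.1
    exact ⟨by omega, h1.2⟩
  have htP := hf.isPartition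
  have huP := hg.isPartition
  have ht1 : 0 < t 1 := by
    rw [← hf.t_zero]
    exact hf.t_strictMono ⟨le_rfl, Nat.zero_le _⟩ ⟨Nat.zero_le _, hn⟩ one_pos
  have hu1 : 0 < u 1 := by
    rw [← hg.t_zero]
    exact hg.t_strictMono ⟨le_rfl, Nat.zero_le _⟩ ⟨Nat.zero_le _, hn⟩ one_pos
  obtain ⟨K, hBf⟩ := hDf.exists_backwardEquation hD
  obtain ⟨K', hBg⟩ := hDg.exists_backwardEquation hD
  have hti : ∀ i, 2 ≤ i → i ≤ n → 0 < t (i - 1) ∧ t (i - 1) ≤ t i ∧ t i ≤ a := fun i hi hin =>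
    ⟨ht1.trans_le (htP.mono (by omega) (by omega)), htP.mono (by omega) hin,
      (htP.mono hin le_rfl).trans htP.le⟩
  refine ⟨fun i hi hin h _ x₁ => ?_, ?_⟩
  · obtain ⟨h1, h2, h3⟩ := hti i hi hin
    have hπi := hπ2 i hi hin
    refine ⟨fun w hw => hBf.inDomain ⟨h1.trans_le hw.1, hw.2⟩ h3 _, fun v hv y => ?_,
      (SetMarkov.integral_lhsIntegrand hBf huP hπ2 hi hin h1 h2 h3 h x₁).1,
      (SetMarkov.integral_rhsIntegrand hBg huP hu1 hπ2 hi hin h x₁).1⟩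
    exact hBg.inDomain
      ⟨(hu1.trans_le (huP.mono (by omega) (by omega))).trans_le hv.1, hv.2⟩
      ((huP.mono hπi.2 le_rfl).trans huP.le)
      ((SetMarkov.isBddMeas_tailMean (π := π) (Pg := Pg) (u := u) h i x₁).section_right y).toBR
  · have hQ : ∀ x, Pf.Q (t 0) (t 1) x = Pg.Q (u 0) (u 1) x := by
      rw [hf.t_zero, hg.t_zero]
      exact h01
    rw [SetMarkov.integralCondition_iff hn, SetMarkov.sameIncrements_iff hn htP hQ]
    have hiff : ∀ i, 2 ≤ i → i ≤ n → ∀ h : ℕ → SetMarkov.BR,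
        (∀ᵐ x₁ ∂(μ.bind (Pf.Q 0 (t 1))),
          ∫ w in (t (i - 1))..(t i), SetMarkov.lhsIntegrand π Pf Pg t u h i x₁ w =
            ∫ v in (u (π i - 1))..(u (π i)), SetMarkov.rhsIntegrand π Pg u h i x₁ v) ↔
        ∀ c₀ c₁, SetMarkov.Predicts Pf t (SetMarkov.pathLaw Pg u n μ) π i c₀ c₁ h := by
      intro i hi hin h
      obtain ⟨h1, h2, h3⟩ := hti i hi hin
      rw [← SetMarkov.ae_pathMean_eq_iff hn hπ2 hQ hin h, hf.t_zero]
      simp only [SetMarkov.integral_lhs_eq_rhs_iff hBf hBg huP hu1 hπ2 hi hin h1 h2 h3 h]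
    constructor
    · intro H i hi hin h _
      exact (hiff i hi hin h).2 fun c₀ c₁ => H i hi hin c₀ c₁ h
    · intro H i hi hin c₀ c₁
      exact SetMarkov.predicts_of_dense hD fun h hh =>
        (hiff i hi hin h).1 (H i hi hin h fun j _ _ => hh j) c₀ c₁
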